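/- For nonnegative integers $a,b$, the $a$ by $b$ undented Aztec rectangle is the union of the unit lattice squares (with integer corners) contained in the region $x+y\le b+1$, $x+y\ge b-2a-1$, $y-x\le b+1$, $y-x\ge -(b+1)$. For an integer $\delta$, its diagonal $\delta$ consists of the squares whose lower left corner lies on $y-x=\delta$; if $\delta\equiv b-1 \pmod 2$ and $|\delta|<b$, this diagonal has $a+1$ squares, which we index by $0,1,\dots,a$ from lower left to upper right. A domino is the union of two unit lattice squares sharing an edge. Put $V_n=1!\,2!\cdots n!$, so that $V_0=1$; empty products and determinants of empty matrices are $1$, and $0^0=1$. Let $a<b\le 2a+1$, let $0\le r_0<r_1<\dots<r_{b-a-1}\le a$ be integers, and let $t_0<t_1<\dots<t_{2a-b}$ be the elements of $\{0,1,\dots,a\}\setminus\{r_0,\dots,r_{b-a-1}\}$. (i) If $b=2k+1$, the number of domino tilings of the $a$ by $b$ undented Aztec rectangle with the squares with indices $r_0,\dots,r_{b-a-1}$ removed from the diagonal $\delta=0$ (the diagonal of length $a+1$ through the centre) is \[ \frac{2^{k^2+a}}{V_k^2}\Bigl(\prod_{0\le j<i<2k+1-a}(r_i-r_j)^2\prod_{\substack{0\le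 i<2a-2k\\ 0\le j<2k+1-a}}|t_i-r_j|\Bigr)\det\bigl(t_{2i}^{\,j}\bigr)_{0\le i,j\le a-k-1}\det\bigl(t_{2i+1}^{\,j}\bigr)_{0\le i,j\le a-k-1}. \] (ii) If $b=2k$, the number of domino tilings of the $a$ by $b$ undented Aztec rectangle with the squares with indices $r_0,\dots,r_{b-a-1}$ removed from either one of the two diagonals $\delta=1$, $\delta=-1$ (the diagonals of length $a+1$ next to the centre) is \[ \frac{2^{k^2-k+a}}{V_{k-1}V_k}\Bigl(\prod_{0\le j<i<2k-a}(r_i-r_j)^2\prod_{\substack{0\le i<2a-2k+1\\ 0\le j<2k-a}}|t_i-r_j|\Bigr)\det\bigl(t_{2i}^{\,j}\bigr)_{0\le i,j\le a-k}\det\bigl(t_{2i+1}^{\,j}\bigr)_{0\le i,j\le a-k-1}. \] -/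

import Mathlib

/-- A domino: a set of two unit lattice squares sharing an edge. The unit square
`[x, x+1] × [y, y+1]` is represented by its lower left corner `(x, y)`. -/
def IsDomino (D : Finset (ℤ × ℤ)) : Prop :=
  ∃ c ∈ D, D = {c, (c.1 + 1, c.2)} ∨ D = {c, (c.1, c.2 + 1)}

instance (D : Finset (ℤ × ℤ)) : Decidable (IsDomino D) := by
  unfold IsDomino; infer_instance

/-- The domino tilings of a finite region `R` (a finite set of unit squares): sets of pairwise
disjoint dominoes contained in `R` whose union is `R`. -/
def dominoTilings (R : Finset (ℤ × ℤ)) : Finset (Finset (Finset (ℤ × ℤ))) :=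
  (R.powerset.filter IsDomino).powerset.filter fun T =>
    (∀ D ∈ T, ∀ E ∈ T, D ≠ E → Disjoint D E) ∧ T.sup id = R

/-- The unit square with lower left corner `c` lies in the rectangle bounded by
`x + y ≤ b + 1`, `x + y ≥ b - 2a - 1`, `y - x ≤ b + 1`, `y - x ≥ -(b + 1)`.
(Each inequality is tested at the extreme corner of the square.) -/
def SquareInBounds (a b : ℕ) (c : ℤ × ℤ) : Prop :=
  (c.1 + 1) + (c.2 + 1) ≤ b + 1 ∧ (b : ℤ) - 2 * a - 1 ≤ c.1 + c.2 ∧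
    (c.2 + 1) - c.1 ≤ b + 1 ∧ -((b : ℤ) + 1) ≤ c.2 - (c.1 + 1)

instance (a b : ℕ) (c : ℤ × ℤ) : Decidable (SquareInBounds a b c) := by
  unfold SquareInBounds; infer_instance

/-- The `a` by `b` undented Aztec rectangle: all unit lattice squares in the rectangle
of `SquareInBounds`. The box only serves to make this a finite set, see
`mem_undentedAztecRectangle`. -/
noncomputable def undentedAztecRectangle (a b : ℕ) : Finset (ℤ × ℤ) :=
  (Finset.Icc (-(a : ℤ) - b - 1) (a + b + 1) ×ˢ
    Finset.Icc (-(a : ℤ) - b - 1) (a + b + 1)).filter (SquareInBounds a b)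

theorem mem_undentedAztecRectangle (a b : ℕ) (c : ℤ × ℤ) :
    c ∈ undentedAztecRectangle a b ↔ SquareInBounds a b c := by
  rw [undentedAztecRectangle, Finset.mem_filter, Finset.mem_product, Finset.mem_Icc, Finset.mem_Icc]
  unfold SquareInBounds
  omega

/-- The square `c` is the square with index `i` on the diagonal of squares whose lower left corners
lie on the line `y - x = δ`. Indices count from the lower left end of the diagonal,
where `x + y = b - 2a - 1`; consecutive squares differ by `(1, 1)`. For `δ ≡ b - 1 (mod 2)`
and `|δ| < b` the diagonal consists of `a + 1` squares, with the indices `0, …, a`. -/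
def IsDiagonalSquare (a b : ℕ) (δ : ℤ) (i : ℕ) (c : ℤ × ℤ) : Prop :=
  c.2 - c.1 = δ ∧ c.1 + c.2 = (b : ℤ) - 2 * a - 1 + 2 * i

instance (a b : ℕ) (δ : ℤ) (i : ℕ) (c : ℤ × ℤ) : Decidable (IsDiagonalSquare a b δ i c) := by
  unfold IsDiagonalSquare; infer_instance

/-- The `a` by `b` undented Aztec rectangle from which the squares with indices
`r 0, …, r (m - 1)` of the diagonal `y - x = δ` have been removed. -/
noncomputable def defectiveAztecRectangle (a b : ℕ) (δ : ℤ) (m : ℕ) (r : ℕ → ℕ) : Finset (ℤ × ℤ) :=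
  (undentedAztecRectangle a b).filter fun c => ¬ ∃ i < m, IsDiagonalSquare a b δ (r i) c

/-! ### Domino tilings of arbitrary finite regions -/

section Tilings

/-! Cut the region along the defect diagonal. Squares on one diagonal are never adjacent, so each
surviving square of the diagonal is covered by a domino going up or by one going down. The number of
tilings is therefore a sum, over sets `S` of survivors matched upwards, of a product of two counts
for half regions (`numTilings_cut`).

A half region with `n + 1` squares missing from its bounding diagonal, at the positions `U`, has `2
^ (n * (n + 1) / 2) / V_n` times the Vandermonde product of `U` tilings (`numTilings_half`). This is
proved by a transfer argument in the exterior algebra of `ℚ^(ℕ)`. A set of positions becomes the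
wedge of its basis vectors. Crossing a short diagonal in one direction sends `U` to the contraction
of its wedge with the all-ones form, which is a sum of wedges of differences `e_{i+1} - e_i`
(`ZigZag.sum_left`). Crossing to the next long diagonal replaces each index `i` by `e_i + e_{i+1}`
(`ZigZag.sum_right`). Since `i ^ k + (i + 1) ^ k` is the difference of a polynomial of degree `k +
1` with leading coefficient `2 / (k + 1)`, contraction with the forms `1, x, …, x ^ n` becomes, up
to that constant, contraction with `1, x, …, x ^ (n + 1)`. Iterating leaves a Vandermonde
determinant and the product of the constants.

For each `S`, one half misses the removed squares together with the `t`'s outside `S`, the other the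
removed squares together with those in `S`. All factors involving an `r` are then independent of
`S`. What remains is the sum of `Δ(S) Δ(Sᶜ)` over subsets of the `t`'s of a fixed size, where `Δ` is
the Vandermonde product (`sum_diffProd_mul_diffProd`). By Laplace expansion this is, up to sign, the
determinant with rows `t_i ^ k` and `(-1) ^ i t_i ^ k`. Subtracting the former rows from the latter
annihilates the latter at even `i` and gives `-2 t_i ^ k` at odd `i`, so only the splitting into
even and odd indices survives. -/

/-- Two unit squares sharing an edge. -/
def SqAdj (c d : ℤ × ℤ) : Prop :=
  (d.2 = c.2 ∧ (d.1 = c.1 + 1 ∨ c.1 = d.1 + 1)) ∨ (d.1 = c.1 ∧ (d.2 = c.2 + 1 ∨ c.2 = d.2 + 1))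

instance (c d : ℤ × ℤ) : Decidable (SqAdj c d) := by
  unfold SqAdj; infer_instance

theorem SqAdj.symm {c d : ℤ × ℤ} (h : SqAdj c d) : SqAdj d c := by
  unfold SqAdj at *; omega

theorem SqAdj.ne {c d : ℤ × ℤ} (h : SqAdj c d) : c ≠ d := by
  rintro rfl; unfold SqAdj at h; omega

theorem isDomino_pair {c d : ℤ × ℤ} (h : SqAdj c d) : IsDomino {c, d} := by
  obtain ⟨x, y⟩ := c
  obtain ⟨z, w⟩ := d
  rcases h with ⟨h1, h2 | h2⟩ | ⟨h1, h2 | h2⟩ <;> simp only at h1 h2 <;> subst h1 h2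
  · exact ⟨(x, w), by simp, Or.inl rfl⟩
  · exact ⟨(z, w), by simp, Or.inl (Finset.pair_comm _ _)⟩
  · exact ⟨(z, y), by simp, Or.inr rfl⟩
  · exact ⟨(z, w), by simp, Or.inr (Finset.pair_comm _ _)⟩

theorem IsDomino.exists_pair {D : Finset (ℤ × ℤ)} (hD : IsDomino D) {c : ℤ × ℤ} (hc : c ∈ D) :
    ∃ d, SqAdj c d ∧ D = {c, d} := by
  obtain ⟨e, -, rfl | rfl⟩ := hD <;> rw [Finset.mem_insert, Finset.mem_singleton] at hc <;>
    rcases hc with rfl | rfl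
  · exact ⟨_, by unfold SqAdj; simp, rfl⟩
  · exact ⟨e, by unfold SqAdj; simp, Finset.pair_comm _ _⟩
  · exact ⟨_, by unfold SqAdj; simp, rfl⟩
  · exact ⟨e, by unfold SqAdj; simp, Finset.pair_comm _ _⟩

theorem mem_dominoTilings {R : Finset (ℤ × ℤ)} {T : Finset (Finset (ℤ × ℤ))} :
    T ∈ dominoTilings R ↔ (∀ D ∈ T, D ⊆ R ∧ IsDomino D) ∧
      (∀ D ∈ T, ∀ E ∈ T, D ≠ E → Disjoint D E) ∧ ∀ c ∈ R, ∃ D ∈ T, c ∈ D := by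
  simp only [dominoTilings, Finset.mem_filter, Finset.mem_powerset]
  constructor
  · rintro ⟨h1, h2, rfl⟩
    refine ⟨fun D hD => ?_, h2, fun c hc => ?_⟩
    · have := h1 hD
      rw [Finset.mem_filter, Finset.mem_powerset] at this
      exact this
    · simpa using hc
  · rintro ⟨h1, h2, h3⟩
    refine ⟨fun D hD => ?_, h2, ?_⟩
    · rw [Finset.mem_filter, Finset.mem_powerset]
      exact h1 D hD
    · ext c
      rw [Finset.mem_sup]
      exact ⟨fun ⟨D, hD, hc⟩ => (h1 D hD).1 hc, h3 c⟩

/-- The number of domino tilings of a region. -/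
def numTilings (R : Finset (ℤ × ℤ)) : ℕ := (dominoTilings R).card

theorem numTilings_empty : numTilings ∅ = 1 := by
  unfold numTilings
  rw [Finset.card_eq_one]
  refine ⟨∅, ?_⟩
  ext T
  rw [mem_dominoTilings, Finset.mem_singleton]
  constructor
  · rintro ⟨h1, -, -⟩
    rw [Finset.eq_empty_iff_forall_notMem]
    intro D hD
    obtain ⟨h, c, hc, -⟩ := h1 D hD
    exact absurd (h hc) (by simp)
  · rintro rfl
    simp

theorem card_filter_mem_dominoTilings {R : Finset (ℤ × ℤ)} {c d : ℤ × ℤ} (hc : c ∈ R)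
    (hd : d ∈ R) (h : SqAdj c d) :
    ((dominoTilings R).filter fun T => {c, d} ∈ T).card = numTilings ((R.erase c).erase d) := by
  unfold numTilings
  refine Finset.card_bij' (fun T _ => T.erase {c, d}) (fun T _ => insert {c, d} T) ?_ ?_ ?_ ?_
  · intro T hT
    rw [Finset.mem_filter, mem_dominoTilings] at hT
    obtain ⟨⟨h1, h2, h3⟩, h4⟩ := hT
    rw [mem_dominoTilings]
    refine ⟨fun D hD => ?_, fun D hD E hE => h2 D (Finset.mem_of_mem_erase hD) E
      (Finset.mem_of_mem_erase hE), fun e he => ?_⟩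
    · have hD' := Finset.mem_erase.mp hD
      refine ⟨fun e he => ?_, (h1 D hD'.2).2⟩
      have hdis := Finset.disjoint_left.mp (h2 D hD'.2 _ h4 hD'.1) he
      simp only [Finset.mem_insert, Finset.mem_singleton, not_or] at hdis
      simp only [Finset.mem_erase]
      exact ⟨hdis.2, hdis.1, (h1 D hD'.2).1 he⟩
    · simp only [Finset.mem_erase] at he
      obtain ⟨D, hD, heD⟩ := h3 e he.2.2
      refine ⟨D, Finset.mem_erase.mpr ⟨?_, hD⟩, heD⟩
      rintro rfl
      simp [he.1, he.2.1] at heD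
  · intro T hT
    rw [mem_dominoTilings] at hT
    obtain ⟨h1, h2, h3⟩ := hT
    rw [Finset.mem_filter, mem_dominoTilings]
    have hdis : ∀ D ∈ T, Disjoint D {c, d} := by
      intro D hD
      rw [Finset.disjoint_left]
      intro e he
      have := (h1 D hD).1 he
      simp only [Finset.mem_erase] at this
      simp [this.1, this.2.1]
    refine ⟨⟨?_, ?_, ?_⟩, Finset.mem_insert_self _ _⟩
    · intro D hD
      rcases Finset.mem_insert.mp hD with rfl | hD
      · refine ⟨?_, isDomino_pair h⟩
        rw [Finset.insert_subset_iff, Finset.singleton_subset_iff]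
        exact ⟨hc, hd⟩
      · exact ⟨(h1 D hD).1.trans ((Finset.erase_subset _ _).trans (Finset.erase_subset _ _)),
          (h1 D hD).2⟩
    · intro D hD E hE hDE
      rcases Finset.mem_insert.mp hD with rfl | hD <;> rcases Finset.mem_insert.mp hE with rfl | hE
      · exact absurd rfl hDE
      · exact (hdis E hE).symm
      · exact hdis D hD
      · exact h2 D hD E hE hDE
    · intro e he
      by_cases hec : e = c ∨ e = d
      · exact ⟨_, Finset.mem_insert_self _ _, by simpa using hec⟩
      · rw [not_or] at hec
        obtain ⟨D, hD, heD⟩ := h3 e (by simp [hec.1, hec.2, he])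
        exact ⟨D, Finset.mem_insert_of_mem hD, heD⟩
  · intro T hT
    exact Finset.insert_erase (Finset.mem_filter.mp hT).2
  · intro T hT
    refine Finset.erase_insert fun hmem => ?_
    have := ((mem_dominoTilings.mp hT).1 _ hmem).1 (Finset.mem_insert_self c {d})
    simp at this

/-- Expanding the number of tilings according to the domino covering the square `c`. -/
theorem numTilings_expand {R : Finset (ℤ × ℤ)} {c : ℤ × ℤ} (hc : c ∈ R) :
    numTilings R = ∑ d ∈ R.filter (SqAdj c), numTilings ((R.erase c).erase d) := by
  have h1 : dominoTilings R = (R.filter (SqAdj c)).biUnion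
      fun d => (dominoTilings R).filter fun T => {c, d} ∈ T := by
    ext T
    simp only [Finset.mem_biUnion, Finset.mem_filter]
    refine ⟨fun hT => ?_, fun ⟨d, _, hT, _⟩ => hT⟩
    have hT' := mem_dominoTilings.mp hT
    obtain ⟨D, hD, hcD⟩ := hT'.2.2 c hc
    obtain ⟨d, hd, rfl⟩ := (hT'.1 D hD).2.exists_pair hcD
    exact ⟨d, ⟨(hT'.1 _ hD).1 (by simp), hd⟩, hT, hD⟩
  conv_lhs => rw [numTilings, h1]
  rw [Finset.card_biUnion]
  · refine Finset.sum_congr rfl fun d hd => ?_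
    rw [Finset.mem_filter] at hd
    exact card_filter_mem_dominoTilings hc hd.1 hd.2
  · intro d hd e he hde
    rw [Function.onFun, Finset.disjoint_left]
    intro T hT hT'
    rw [Finset.mem_filter] at hT hT'
    rw [Finset.mem_coe, Finset.mem_filter] at hd he
    refine absurd ((mem_dominoTilings.mp hT.1).2.1 _ hT.2 _ hT'.2 ?_) ?_
    · intro h
      have : d ∈ ({c, e} : Finset (ℤ × ℤ)) := h ▸ (by simp)
      rw [Finset.mem_insert, Finset.mem_singleton] at this
      rcases this with rfl | rfl
      · exact hd.2.ne rfl
      · exact hde rfl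
    · rw [Finset.disjoint_left]
      push Not
      exact ⟨c, by simp, by simp⟩

theorem numTilings_eq_zero {R : Finset (ℤ × ℤ)} {c : ℤ × ℤ} (hc : c ∈ R)
    (h : ∀ d ∈ R, ¬ SqAdj c d) : numTilings R = 0 := by
  rw [numTilings_expand hc, Finset.filter_false_of_mem h, Finset.sum_empty]

theorem numTilings_forced {R : Finset (ℤ × ℤ)} {c d : ℤ × ℤ} (hc : c ∈ R) (hd : d ∈ R)
    (hcd : SqAdj c d) (h : ∀ e ∈ R, SqAdj c e → e = d) :
    numTilings R = numTilings ((R.erase c).erase d) := by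
  have : R.filter (SqAdj c) = {d} := by
    ext e
    rw [Finset.mem_filter, Finset.mem_singleton]
    exact ⟨fun he => h e he.1 he.2, fun he => he ▸ ⟨hd, hcd⟩⟩
  rw [numTilings_expand hc, this, Finset.sum_singleton]

/-- Cutting a region along an independent set `C` separating `A` from `B`. -/
theorem numTilings_cut (A : Finset (ℤ × ℤ)) : ∀ (C B : Finset (ℤ × ℤ)), Disjoint A C →
    Disjoint A B → Disjoint C B → (∀ c ∈ C, ∀ d ∈ C, ¬ SqAdj c d) →
    (∀ c ∈ A, ∀ d ∈ B, ¬ SqAdj c d) →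
    numTilings (A ∪ C ∪ B) = ∑ S ∈ C.powerset, numTilings (A ∪ S) * numTilings (B ∪ (C \ S)) := by
  induction A using Finset.strongInduction with
  | H A ih =>
  intro C B hAC hAB hCB hC hABadj
  rcases A.eq_empty_or_nonempty with rfl | ⟨c, hc⟩
  · rw [Finset.sum_eq_single ∅]
    · simp [numTilings_empty, Finset.union_comm]
    · intro S hS hne
      obtain ⟨c, hc⟩ := Finset.nonempty_iff_ne_empty.mpr hne
      rw [Finset.mem_powerset] at hS
      rw [numTilings_eq_zero (c := c) (by simpa using hc), zero_mul]
      intro d hd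
      rw [Finset.empty_union] at hd
      exact hC c (hS hc) d (hS hd)
    · simp
  · have hcC : c ∉ C := Finset.disjoint_left.mp hAC hc
    have hcB : c ∉ B := Finset.disjoint_left.mp hAB hc
    -- The domino covering `c` ends in `A` or in `C`, never in `B`. Both sides of the claim satisfy
    -- the resulting recursion.
    have hexp : numTilings (A ∪ C ∪ B)
        = ∑ d ∈ A.filter (SqAdj c), numTilings ((A.erase c).erase d ∪ C ∪ B)
          + ∑ d ∈ C.filter (SqAdj c), numTilings (A.erase c ∪ C.erase d ∪ B) := by
      rw [numTilings_expand (c := c) (by simp [hc])]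
      have hfil : (A ∪ C ∪ B).filter (SqAdj c) = A.filter (SqAdj c) ∪ C.filter (SqAdj c) := by
        rw [Finset.filter_union, Finset.filter_union,
          Finset.filter_false_of_mem (s := B) (hABadj c hc), Finset.union_empty]
      rw [hfil, Finset.sum_union (Finset.disjoint_filter_filter hAC)]
      congr 1
      · refine Finset.sum_congr rfl fun d hd => congrArg numTilings ?_
        have hdA := (Finset.mem_filter.mp hd).1
        have hdC : d ∉ C := Finset.disjoint_left.mp hAC hdA
        have hdB : d ∉ B := Finset.disjoint_left.mp hAB hdA
        simp only [Finset.erase_union_distrib, Finset.erase_eq_of_notMem hcC,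
          Finset.erase_eq_of_notMem hcB, Finset.erase_eq_of_notMem hdC,
          Finset.erase_eq_of_notMem hdB]
      · refine Finset.sum_congr rfl fun d hd => congrArg numTilings ?_
        have hdC := (Finset.mem_filter.mp hd).1
        have hdA : d ∉ A.erase c := fun h =>
          Finset.disjoint_left.mp hAC (Finset.mem_of_mem_erase h) hdC
        have hdB : d ∉ B := Finset.disjoint_left.mp hCB hdC
        simp only [Finset.erase_union_distrib, Finset.erase_eq_of_notMem hcC,
          Finset.erase_eq_of_notMem hcB, Finset.erase_eq_of_notMem hdA,
          Finset.erase_eq_of_notMem hdB]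
    have hexpS : ∀ S ∈ C.powerset, numTilings (A ∪ S)
        = ∑ d ∈ A.filter (SqAdj c), numTilings ((A.erase c).erase d ∪ S)
          + ∑ d ∈ S.filter (SqAdj c), numTilings (A.erase c ∪ S.erase d) := by
      intro S hS
      rw [Finset.mem_powerset] at hS
      have hAS : Disjoint A S := hAC.mono_right hS
      have hcS : c ∉ S := Finset.disjoint_left.mp hAS hc
      rw [numTilings_expand (c := c) (by simp [hc]), Finset.filter_union,
        Finset.sum_union (Finset.disjoint_filter_filter hAS)]
      congr 1
      · refine Finset.sum_congr rfl fun d hd => congrArg numTilings ?_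
        have hdS : d ∉ S := Finset.disjoint_left.mp hAS (Finset.mem_filter.mp hd).1
        simp only [Finset.erase_union_distrib, Finset.erase_eq_of_notMem hcS,
          Finset.erase_eq_of_notMem hdS]
      · refine Finset.sum_congr rfl fun d hd => congrArg numTilings ?_
        have hdA : d ∉ A.erase c := fun h =>
          Finset.disjoint_left.mp hAS (Finset.mem_of_mem_erase h) (Finset.mem_filter.mp hd).1
        simp only [Finset.erase_union_distrib, Finset.erase_eq_of_notMem hcS,
          Finset.erase_eq_of_notMem hdA]
    have hsum : ∑ S ∈ C.powerset, numTilings (A ∪ S) * numTilings (B ∪ (C \ S))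
        = ∑ S ∈ C.powerset, (∑ d ∈ A.filter (SqAdj c), numTilings ((A.erase c).erase d ∪ S))
            * numTilings (B ∪ (C \ S))
          + ∑ S ∈ C.powerset, (∑ d ∈ S.filter (SqAdj c), numTilings (A.erase c ∪ S.erase d))
            * numTilings (B ∪ (C \ S)) := by
      rw [← Finset.sum_add_distrib]
      exact Finset.sum_congr rfl fun S hS => by rw [hexpS S hS, add_mul]
    rw [hexp, hsum]
    have hss : A.erase c ⊂ A := Finset.erase_ssubset hc
    congr 1
    · simp only [Finset.sum_mul]
      rw [Finset.sum_comm]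
      refine Finset.sum_congr rfl fun d _ => ?_
      have hsub : (A.erase c).erase d ⊆ A :=
        (Finset.erase_subset _ _).trans (Finset.erase_subset _ _)
      exact ih _ (lt_of_le_of_lt (Finset.erase_subset _ _) hss) C B (hAC.mono_left hsub)
        (hAB.mono_left hsub) hCB hC fun x hx y hy => hABadj x (hsub hx) y hy
    · have hterm : ∀ d ∈ C.filter (SqAdj c), numTilings (A.erase c ∪ C.erase d ∪ B)
          = ∑ S ∈ C.powerset.filter (fun S => d ∈ S),
            numTilings (A.erase c ∪ S.erase d) * numTilings (B ∪ (C \ S)) := by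
        intro d hd
        have hdC := (Finset.mem_filter.mp hd).1
        rw [ih _ hss (C.erase d) B
          ((hAC.mono_left (Finset.erase_subset _ _)).mono_right (Finset.erase_subset _ _))
          (hAB.mono_left (Finset.erase_subset _ _)) (hCB.mono_left (Finset.erase_subset _ _))
          (fun x hx y hy => hC x (Finset.mem_of_mem_erase hx) y (Finset.mem_of_mem_erase hy))
          (fun x hx y hy => hABadj x (Finset.mem_of_mem_erase hx) y hy)]
        refine Finset.sum_bij' (fun S _ => insert d S) (fun S _ => S.erase d) ?_ ?_ ?_ ?_ ?_
        · intro S hS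
          rw [Finset.mem_powerset] at hS
          simp only [Finset.mem_filter, Finset.mem_powerset, Finset.mem_insert_self, and_true]
          exact Finset.insert_subset hdC (hS.trans (Finset.erase_subset _ _))
        · intro S hS
          simp only [Finset.mem_filter, Finset.mem_powerset] at hS ⊢
          exact Finset.erase_subset_erase _ hS.1
        · intro S hS
          rw [Finset.mem_powerset] at hS
          exact Finset.erase_insert fun h => by simpa using hS h
        · intro S hS
          exact Finset.insert_erase (Finset.mem_filter.mp hS).2
        · intro S hS
          rw [Finset.mem_powerset] at hS
          have hdS : d ∉ S := fun h => by simpa using hS h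
          rw [Finset.erase_insert hdS]
          congr 3
          ext x
          simp only [Finset.mem_sdiff, Finset.mem_erase, Finset.mem_insert]
          tauto
      rw [Finset.sum_congr rfl hterm]
      simp only [Finset.sum_mul]
      refine Finset.sum_comm' fun d S => ?_
      simp only [Finset.mem_filter, Finset.mem_powerset]
      constructor
      · rintro ⟨⟨_, h2⟩, h3, h4⟩; exact ⟨⟨h4, h2⟩, h3⟩
      · rintro ⟨⟨h4, h2⟩, h3⟩; exact ⟨⟨h3 h4, h2⟩, h3, h4⟩

theorem sqAdj_swap {c d : ℤ × ℤ} : SqAdj c.swap d.swap ↔ SqAdj c d := by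
  unfold SqAdj; simp only [Prod.fst_swap, Prod.snd_swap]; omega

/-- Reflecting a region in the line `y = x` does not change the number of its tilings. -/
theorem numTilings_image_swap (R : Finset (ℤ × ℤ)) :
    numTilings (R.image Prod.swap) = numTilings R := by
  induction R using Finset.strongInduction with
  | H R ih =>
  rcases R.eq_empty_or_nonempty with rfl | ⟨c, hc⟩
  · simp
  · rw [numTilings_expand hc, numTilings_expand (c := c.swap) (Finset.mem_image_of_mem _ hc),
      Finset.filter_image, Finset.sum_image Prod.swap_injective.injOn]
    simp only [sqAdj_swap]
    refine Finset.sum_congr rfl fun d _ => ?_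
    rw [← Finset.image_erase Prod.swap_injective, ← Finset.image_erase Prod.swap_injective]
    exact ih _ (lt_of_le_of_lt (Finset.erase_subset _ _) (Finset.erase_ssubset hc))

end Tilings

/-! ### Iterated contractions in the exterior algebra -/

section Exterior

open ExteriorAlgebra

variable {M M' : Type*} [AddCommGroup M] [Module ℚ M] [AddCommGroup M'] [Module ℚ M']

/-- The interior product with a linear form, acting from the left. -/
noncomputable def contr (d : Module.Dual ℚ M) :
    ExteriorAlgebra ℚ M →ₗ[ℚ] ExteriorAlgebra ℚ M :=
  CliffordAlgebra.contractLeft (Q := (0 : QuadraticForm ℚ M)) d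

/-- The grade involution of the exterior algebra. -/
noncomputable def gradeInvol : ExteriorAlgebra ℚ M →ₐ[ℚ] ExteriorAlgebra ℚ M :=
  CliffordAlgebra.involute (Q := (0 : QuadraticForm ℚ M))

theorem gradeInvol_ι (m : M) : gradeInvol (ι ℚ m) = -ι ℚ m :=
  CliffordAlgebra.involute_ι m

theorem contr_one (d : Module.Dual ℚ M) : contr d 1 = 0 :=
  CliffordAlgebra.contractLeft_one _ d

theorem contr_algebraMap (d : Module.Dual ℚ M) (r : ℚ) :
    contr d (algebraMap ℚ _ r) = 0 :=
  CliffordAlgebra.contractLeft_algebraMap _ d r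

theorem contr_ι_mul (d : Module.Dual ℚ M) (m : M) (x : ExteriorAlgebra ℚ M) :
    contr d (ι ℚ m * x) = d m • x - ι ℚ m * contr d x :=
  CliffordAlgebra.contractLeft_ι_mul d m x

theorem contr_contr (d : Module.Dual ℚ M) (x : ExteriorAlgebra ℚ M) :
    contr d (contr d x) = 0 :=
  CliffordAlgebra.contractLeft_contractLeft d x

theorem contr_comm (d e : Module.Dual ℚ M) (x : ExteriorAlgebra ℚ M) :
    contr d (contr e x) = -contr e (contr d x) :=
  CliffordAlgebra.contractLeft_comm _ _ x

theorem contr_add (d e : Module.Dual ℚ M) (x : ExteriorAlgebra ℚ M) :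
    contr (d + e) x = contr d x + contr e x := by
  simp [contr]

theorem contr_smul (c : ℚ) (d : Module.Dual ℚ M) (x : ExteriorAlgebra ℚ M) :
    contr (c • d) x = c • contr d x := by
  simp [contr]

theorem contr_zero (x : ExteriorAlgebra ℚ M) : contr (0 : Module.Dual ℚ M) x = 0 := by
  simp [contr]

/-- An induction principle: a linear statement holds if it holds for scalars and is preserved by
left multiplication with vectors. -/
theorem exterior_left_induction {C : ExteriorAlgebra ℚ M → Prop}
    (h0 : ∀ r, C (algebraMap ℚ _ r)) (hadd : ∀ x y, C x → C y → C (x + y))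
    (hmul : ∀ m x, C x → C (ι ℚ m * x)) (x : ExteriorAlgebra ℚ M) : C x :=
  CliffordAlgebra.left_induction (Q := (0 : QuadraticForm ℚ M)) h0 hadd
    (fun x m hx => hmul m x hx) x

theorem contr_mul (d : Module.Dual ℚ M) (x y : ExteriorAlgebra ℚ M) :
    contr d (x * y) = contr d x * y + gradeInvol x * contr d y := by
  induction x using exterior_left_induction with
  | h0 r =>
    rw [contr_algebraMap, AlgHom.commutes, ← Algebra.smul_def, ← Algebra.smul_def, map_smul]
    simp
  | hadd x x' hx hx' => simp only [add_mul, map_add, hx, hx']; abel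
  | hmul m x hx =>
    rw [mul_assoc, contr_ι_mul, hx, contr_ι_mul, map_mul, gradeInvol_ι, sub_mul, mul_add,
      smul_mul_assoc, mul_assoc, neg_mul, neg_mul, mul_assoc]
    abel

theorem contr_mul_ι (d : Module.Dual ℚ M) (x : ExteriorAlgebra ℚ M) (m : M) :
    contr d (x * ι ℚ m) = contr d x * ι ℚ m + d m • gradeInvol x := by
  have h : contr d (ι ℚ m) = algebraMap ℚ _ (d m) := CliffordAlgebra.contractLeft_ι _ d m
  rw [contr_mul, h, ← Algebra.commutes, ← Algebra.smul_def]

theorem contr_map (A : M →ₗ[ℚ] M') (d : Module.Dual ℚ M') (x : ExteriorAlgebra ℚ M) :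
    contr d (map A x) = map A (contr (d ∘ₗ A) x) := by
  induction x using exterior_left_induction with
  | h0 r => simp only [AlgHom.commutes, contr_algebraMap, map_zero]
  | hadd x x' hx hx' => simp only [map_add, hx, hx']
  | hmul m x hx =>
    rw [map_mul, map_apply_ι, contr_ι_mul, contr_ι_mul, map_sub, map_smul, map_mul,
      map_apply_ι, hx]
    rfl

/-- The degree zero part of an element of the exterior algebra. -/
noncomputable def scalarPart : ExteriorAlgebra ℚ M →ₐ[ℚ] ℚ := algebraMapInv

theorem scalarPart_ι (m : M) : scalarPart (ι ℚ m) = 0 := by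
  simp [scalarPart, algebraMapInv]

theorem scalarPart_map (A : M →ₗ[ℚ] M') (x : ExteriorAlgebra ℚ M) :
    scalarPart (map A x) = scalarPart x := by
  have : scalarPart.comp (map A) = (scalarPart : ExteriorAlgebra ℚ M →ₐ[ℚ] ℚ) := by
    apply hom_ext; ext m; simp [scalarPart_ι]
  exact DFunLike.congr_fun this x

theorem scalarPart_gradeInvol (x : ExteriorAlgebra ℚ M) :
    scalarPart (gradeInvol x) = scalarPart x := by
  have : scalarPart.comp gradeInvol = (scalarPart : ExteriorAlgebra ℚ M →ₐ[ℚ] ℚ) := by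
    apply hom_ext; ext m; simp [scalarPart_ι, gradeInvol_ι]
  exact DFunLike.congr_fun this x

/-- The iterated interior product with `f 0`, then `f 1`, …, then `f (n - 1)`. -/
noncomputable def iterContr (f : ℕ → Module.Dual ℚ M) :
    ℕ → ExteriorAlgebra ℚ M →ₗ[ℚ] ExteriorAlgebra ℚ M
  | 0 => LinearMap.id
  | n + 1 => contr (f n) ∘ₗ iterContr f n

theorem iterContr_zero (f : ℕ → Module.Dual ℚ M) (x : ExteriorAlgebra ℚ M) :
    iterContr f 0 x = x := rfl

theorem iterContr_succ (f : ℕ → Module.Dual ℚ M) (n : ℕ) (x : ExteriorAlgebra ℚ M) :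
    iterContr f (n + 1) x = contr (f n) (iterContr f n x) := rfl

theorem iterContr_succ' (f : ℕ → Module.Dual ℚ M) (n : ℕ) (x : ExteriorAlgebra ℚ M) :
    iterContr f (n + 1) x = iterContr (fun k => f (k + 1)) n (contr (f 0) x) := by
  induction n with
  | zero => rfl
  | succ n ih => rw [iterContr_succ, ih]; rfl

/-- Naturality: a linear change of the vectors can be traded for a change of the forms. -/
theorem iterContr_map (A : M →ₗ[ℚ] M') (f : ℕ → Module.Dual ℚ M') (n : ℕ)
    (x : ExteriorAlgebra ℚ M) :
    iterContr f n (map A x) = map A (iterContr (fun k => f k ∘ₗ A) n x) := by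
  induction n with
  | zero => rfl
  | succ n ih => rw [iterContr_succ, ih, contr_map, iterContr_succ]

theorem iterContr_of_contr_eq_zero (d : Module.Dual ℚ M) (f : ℕ → Module.Dual ℚ M) (n : ℕ)
    (x : ExteriorAlgebra ℚ M) (hx : contr d x = 0) : contr d (iterContr f n x) = 0 := by
  induction n with
  | zero => exact hx
  | succ n ih => rw [iterContr_succ, contr_comm, ih, map_zero, neg_zero]

theorem contr_iterContr_of_lt (f : ℕ → Module.Dual ℚ M) {n i : ℕ} (hi : i < n)
    (x : ExteriorAlgebra ℚ M) : contr (f i) (iterContr f n x) = 0 := by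
  induction n with
  | zero => omega
  | succ n ih =>
    rw [iterContr_succ]
    rcases Nat.lt_succ_iff_lt_or_eq.mp hi with h | rfl
    · rw [contr_comm, ih h, map_zero, neg_zero]
    · exact contr_contr _ _

/-- Linear forms annihilating an element by interior multiplication form a subspace. -/
theorem contr_eq_zero_of_mem_span (x : ExteriorAlgebra ℚ M) (s : Set (Module.Dual ℚ M))
    (hs : ∀ d ∈ s, contr d x = 0) {e : Module.Dual ℚ M} (he : e ∈ Submodule.span ℚ s) :
    contr e x = 0 := by
  induction he using Submodule.span_induction with
  | mem d hd => exact hs d hd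
  | zero => exact contr_zero x
  | add d e _ _ hd he => rw [contr_add, hd, he, add_zero]
  | smul c d _ hd => rw [contr_smul, hd, smul_zero]

/-- Row reduction: after contraction with `g 0, …, g (n - 1)`, any combination of these forms
contracts to zero, so only the leading term of `f n` counts. -/
theorem iterContr_triangular (f g : ℕ → Module.Dual ℚ M) (c : ℕ → ℚ)
    (h : ∀ n, f n - c n • g n ∈ Submodule.span ℚ (g '' Set.Iio n)) (n : ℕ)
    (x : ExteriorAlgebra ℚ M) :
    iterContr f n x = (∏ i ∈ Finset.range n, c i) • iterContr g n x := by
  induction n with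
  | zero => simp [iterContr_zero]
  | succ n ih =>
    rw [iterContr_succ, ih, map_smul, iterContr_succ, Finset.prod_range_succ, mul_smul]
    congr 1
    have h1 : contr (f n - c n • g n) (iterContr g n x) = 0 := by
      refine contr_eq_zero_of_mem_span _ _ ?_ (h n)
      rintro _ ⟨i, hi, rfl⟩
      exact contr_iterContr_of_lt g hi x
    have h2 : f n = (f n - c n • g n) + c n • g n := by abel
    rw [h2, contr_add, h1, zero_add, contr_smul]

/-- The exterior product of the vectors `v i`, `i ∈ U`, `i < n`, in increasing order. -/
noncomputable def wedge (v : ℕ → M) : ℕ → Finset ℕ → ExteriorAlgebra ℚ M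
  | 0, _ => 1
  | n + 1, U => wedge v n U * if n ∈ U then ι ℚ (v n) else 1

theorem wedge_zero (v : ℕ → M) (U : Finset ℕ) : wedge v 0 U = 1 := rfl

theorem wedge_succ_of_mem (v : ℕ → M) {n : ℕ} {U : Finset ℕ} (h : n ∈ U) :
    wedge v (n + 1) U = wedge v n U * ι ℚ (v n) := by simp [wedge, h]

theorem wedge_succ_of_notMem (v : ℕ → M) {n : ℕ} {U : Finset ℕ} (h : n ∉ U) :
    wedge v (n + 1) U = wedge v n U := by simp [wedge, h]

theorem wedge_congr (v : ℕ → M) {n : ℕ} {U U' : Finset ℕ} (h : ∀ i < n, i ∈ U ↔ i ∈ U') :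
    wedge v n U = wedge v n U' := by
  induction n with
  | zero => rfl
  | succ n ih => simp only [wedge, h n (by omega), ih fun i hi => h i (by omega)]

theorem wedge_insert (v : ℕ → M) (n : ℕ) (U : Finset ℕ) :
    wedge v n (insert n U) = wedge v n U :=
  wedge_congr v fun i hi => by simp [hi.ne]

theorem wedge_succ_insert (v : ℕ → M) (n : ℕ) (U : Finset ℕ) :
    wedge v (n + 1) (insert n U) = wedge v n U * ι ℚ (v n) := by
  rw [wedge_succ_of_mem v (by simp), wedge_insert]

theorem wedge_map (A : M →ₗ[ℚ] M') (v : ℕ → M) (n : ℕ) (U : Finset ℕ) :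
    map A (wedge v n U) = wedge (fun i => A (v i)) n U := by
  induction n with
  | zero => simp [wedge_zero]
  | succ n ih => by_cases h : n ∈ U <;> simp [wedge, h, ih]

theorem wedge_smul (c : ℕ → ℚ) (v : ℕ → M) (n : ℕ) (U : Finset ℕ) (hU : U ⊆ Finset.range n) :
    wedge (fun i => c i • v i) n U = (∏ i ∈ U, c i) • wedge v n U := by
  have key : ∀ n, wedge (fun i => c i • v i) n U
      = (∏ i ∈ Finset.range n, if i ∈ U then c i else 1) • wedge v n U := by
    intro n
    induction n with
    | zero => simp [wedge_zero]
    | succ n ih =>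
      by_cases h : n ∈ U
      · rw [wedge_succ_of_mem _ h, wedge_succ_of_mem _ h, ih, Finset.prod_range_succ, if_pos h,
          map_smul, smul_mul_smul_comm]
      · rw [wedge_succ_of_notMem _ h, wedge_succ_of_notMem _ h, ih, Finset.prod_range_succ,
          if_neg h, mul_one]
  rw [key, Finset.prod_ite_mem, Finset.inter_eq_right.mpr hU]

theorem gradeInvol_wedge (v : ℕ → M) (n : ℕ) (U : Finset ℕ) (hU : U ⊆ Finset.range n) :
    gradeInvol (wedge v n U) = (-1 : ℚ) ^ U.card • wedge v n U := by
  have h1 : gradeInvol (wedge v n U) = wedge (fun i => (-1 : ℚ) • v i) n U := by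
    clear hU
    induction n with
    | zero => simp [wedge_zero]
    | succ n ih => by_cases h : n ∈ U <;> simp [wedge, h, ih, gradeInvol_ι]
  rw [h1, wedge_smul _ _ _ _ hU, Finset.prod_const]

theorem scalarPart_mul_ι (x : ExteriorAlgebra ℚ M) (m : M) : scalarPart (x * ι ℚ m) = 0 := by
  rw [map_mul, scalarPart_ι, mul_zero]

end Exterior

/-! ### Vandermonde products over finite index sets -/

section DiffProd

theorem range_succ_sdiff_insert (n : ℕ) (U : Finset ℕ) :
    Finset.range (n + 1) \ insert n U = Finset.range n \ U := by
  ext i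
  simp only [Finset.mem_sdiff, Finset.mem_range, Finset.mem_insert]
  constructor
  · rintro ⟨h1, h2⟩; rw [not_or] at h2; exact ⟨by omega, h2.2⟩
  · rintro ⟨h1, h2⟩; exact ⟨by omega, not_or.mpr ⟨by omega, h2⟩⟩

/-- The product of the differences `t i - t j` over all `j < i` in `U`. -/
noncomputable def diffProd (t : ℕ → ℚ) (U : Finset ℕ) : ℚ :=
  ∏ i ∈ U, ∏ j ∈ U, if j < i then t i - t j else 1

theorem diffProd_empty (t : ℕ → ℚ) : diffProd t ∅ = 1 := by simp [diffProd]

theorem diffProd_union (t : ℕ → ℚ) {A B : Finset ℕ} (h : Disjoint A B) :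
    diffProd t (A ∪ B) = diffProd t A * diffProd t B *
      ∏ i ∈ A, ∏ j ∈ B, if j < i then t i - t j else t j - t i := by
  have h1 : ∏ i ∈ A, ∏ j ∈ B, (if j < i then t i - t j else t j - t i)
      = (∏ i ∈ A, ∏ j ∈ B, if j < i then t i - t j else 1) *
        ∏ i ∈ B, ∏ j ∈ A, if j < i then t i - t j else 1 := by
    rw [Finset.prod_comm (s := B), ← Finset.prod_mul_distrib]
    refine Finset.prod_congr rfl fun i hi => ?_
    rw [← Finset.prod_mul_distrib]
    refine Finset.prod_congr rfl fun j hj => ?_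
    have hne : i ≠ j := fun e => Finset.disjoint_left.mp h hi (e ▸ hj)
    rcases lt_or_gt_of_ne hne with hlt | hlt
    · simp [hlt, not_lt.mpr hlt.le]
    · simp [hlt, not_lt.mpr hlt.le]
  rw [h1]
  unfold diffProd
  simp only [Finset.prod_union h, Finset.prod_mul_distrib]
  ring

theorem diffProd_insert (t : ℕ → ℚ) {n : ℕ} {U : Finset ℕ} (hU : U ⊆ Finset.range n) :
    diffProd t (insert n U) = (∏ i ∈ U, (t n - t i)) * diffProd t U := by
  have hn : n ∉ U := fun h => by simpa using hU h
  rw [Finset.insert_eq, diffProd_union t (by simpa using hn)]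
  have h1 : diffProd t {n} = 1 := by simp [diffProd]
  rw [h1, one_mul, mul_comm, Finset.prod_singleton]
  congr 1
  refine Finset.prod_congr rfl fun i hi => ?_
  rw [if_pos (by simpa using hU hi)]

theorem diffProd_image (t : ℕ → ℚ) (φ : ℕ → ℕ) (U : Finset ℕ)
    (hφ : StrictMonoOn φ (U : Set ℕ)) :
    diffProd t (U.image φ) = diffProd (fun i => t (φ i)) U := by
  unfold diffProd
  rw [Finset.prod_image hφ.injOn]
  refine Finset.prod_congr rfl fun i hi => ?_
  rw [Finset.prod_image hφ.injOn]
  refine Finset.prod_congr rfl fun j hj => ?_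
  simp only [hφ.lt_iff_lt hj hi]

theorem diffProd_range (t : ℕ → ℚ) (n : ℕ) :
    diffProd t (Finset.range n) = ∏ i ∈ Finset.range n, ∏ j ∈ Finset.range i, (t i - t j) := by
  induction n with
  | zero => simp [diffProd]
  | succ n ih =>
    rw [Finset.range_add_one, diffProd_insert t subset_rfl, ih, ← Finset.range_add_one,
      Finset.prod_range_succ, mul_comm]

theorem det_pow_eq_diffProd (t : ℕ → ℚ) (n : ℕ) :
    (Matrix.of fun i j : Fin n => t (i : ℕ) ^ (j : ℕ)).det = diffProd t (Finset.range n) := by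
  have h : (Matrix.of fun i j : Fin n => t (i : ℕ) ^ (j : ℕ))
      = Matrix.vandermonde fun i : Fin n => t i := rfl
  rw [h, Matrix.det_vandermonde, diffProd, ← Fin.prod_univ_eq_prod_range
    (fun i => ∏ j ∈ Finset.range n, if j < i then t i - t j else 1)]
  simp only [← Fin.prod_univ_eq_prod_range
    (fun j => if j < _ then _ - t j else 1)]
  rw [Finset.prod_comm]
  refine Finset.prod_congr rfl fun i _ => ?_
  rw [← Finset.prod_filter]
  refine Finset.prod_congr ?_ fun _ _ => rfl
  ext j
  simp

end DiffProd

/-! ### Contractions as minors, and the sum over splittings -/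

section Minors

open ExteriorAlgebra

variable {M : Type*} [AddCommGroup M] [Module ℚ M]

theorem contr_gradeInvol (d : Module.Dual ℚ M) (x : ExteriorAlgebra ℚ M) :
    contr d (gradeInvol x) = -gradeInvol (contr d x) := by
  induction x using exterior_left_induction with
  | h0 r => simp only [AlgHom.commutes, contr_algebraMap, map_zero, neg_zero]
  | hadd x y hx hy => simp only [map_add, hx, hy]; abel
  | hmul m x hx =>
    rw [map_mul, gradeInvol_ι, neg_mul, map_neg, contr_ι_mul, contr_ι_mul, hx, map_sub, map_smul,
      map_mul, gradeInvol_ι]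
    simp

theorem mul_ι_eq (x : ExteriorAlgebra ℚ M) (m : M) : x * ι ℚ m = ι ℚ m * gradeInvol x := by
  induction x using exterior_left_induction with
  | h0 r => rw [AlgHom.commutes, Algebra.commutes]
  | hadd x y hx hy => rw [map_add, add_mul, mul_add, hx, hy]
  | hmul a x hx =>
    have h := eq_neg_of_add_eq_zero_left (ι_add_mul_swap (R := ℚ) a m)
    rw [mul_assoc, hx, ← mul_assoc, h, map_mul, gradeInvol_ι, neg_mul, neg_mul, mul_neg, mul_assoc]

theorem iterContr_mul_ι (f : ℕ → Module.Dual ℚ M) (n : ℕ) (x : ExteriorAlgebra ℚ M) (m : M)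
    (h : ∀ k, f k m = 0) : iterContr f n (x * ι ℚ m) = iterContr f n x * ι ℚ m := by
  induction n with
  | zero => rfl
  | succ n ih =>
    rw [iterContr_succ, ih, contr_mul_ι, h, zero_smul, add_zero, iterContr_succ]

theorem contr_wedge_eq_zero (d : Module.Dual ℚ M) (v : ℕ → M) (h : ∀ i, d (v i) = 0) (n : ℕ)
    (U : Finset ℕ) : contr d (wedge v n U) = 0 := by
  induction n with
  | zero => exact contr_one d
  | succ n ih =>
    by_cases hn : n ∈ U
    · rw [wedge_succ_of_mem v hn, contr_mul_ι, ih, h, zero_mul, zero_smul, add_zero]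
    · rw [wedge_succ_of_notMem v hn, ih]

theorem iterContr_mul_left (f : ℕ → Module.Dual ℚ M) (n : ℕ) (x y : ExteriorAlgebra ℚ M)
    (h : ∀ k, contr (f k) y = 0) : iterContr f n (x * y) = iterContr f n x * y := by
  induction n with
  | zero => rfl
  | succ n ih => rw [iterContr_succ, ih, contr_mul, h, mul_zero, add_zero, iterContr_succ]

theorem scalarPart_iterContr_mul_right (f : ℕ → Module.Dual ℚ M) (n : ℕ)
    (x y : ExteriorAlgebra ℚ M) (h : ∀ k, contr (f k) x = 0) :
    scalarPart (iterContr f n (x * y)) = scalarPart x * scalarPart (iterContr f n y) := by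
  induction n generalizing f x y with
  | zero => exact map_mul _ _ _
  | succ n ih =>
    rw [iterContr_succ', contr_mul, h, zero_mul, zero_add, ih, scalarPart_gradeInvol,
      ← iterContr_succ']
    intro k
    rw [contr_gradeInvol, h, map_zero, neg_zero]

/-- No sign appears: the `f`'s pass over `y` on its left, and moving the `g`'s past `x` costs only
grade involutions, which the scalar part does not see. -/
theorem scalarPart_iterContr_iterContr_mul (f g : ℕ → Module.Dual ℚ M) (p q : ℕ)
    (x y : ExteriorAlgebra ℚ M) (hf : ∀ k, contr (f k) y = 0) (hg : ∀ k, contr (g k) x = 0) :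
    scalarPart (iterContr g q (iterContr f p (x * y)))
      = scalarPart (iterContr f p x) * scalarPart (iterContr g q y) := by
  rw [iterContr_mul_left f p x y hf, scalarPart_iterContr_mul_right]
  exact fun k => iterContr_of_contr_eq_zero _ _ _ _ (hg k)

/-- The basis vector of `ℕ →₀ ℚ` at `n`. -/
noncomputable def pt (n : ℕ) : ℕ →₀ ℚ := Finsupp.single n 1

/-- The linear form on `ℕ →₀ ℚ` with values `f n` on the basis. -/
noncomputable def evalForm (f : ℕ → ℚ) : Module.Dual ℚ (ℕ →₀ ℚ) := Finsupp.linearCombination ℚ f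

theorem evalForm_pt (f : ℕ → ℚ) (n : ℕ) : evalForm f (pt n) = f n := by simp [evalForm, pt]

/-- The linear map from `ℕ →₀ ℚ` with values `v n` on the basis. -/
noncomputable def ptMap (v : ℕ → M) : (ℕ →₀ ℚ) →ₗ[ℚ] M := Finsupp.linearCombination ℚ v

theorem ptMap_pt (v : ℕ → M) (n : ℕ) : ptMap v (pt n) = v n := by simp [ptMap, pt]

theorem map_ptMap_wedge (v : ℕ → M) (n : ℕ) (U : Finset ℕ) :
    map (ptMap v) (wedge pt n U) = wedge v n U := by
  rw [wedge_map]; simp only [ptMap_pt]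

theorem hom_pt_ext {f g : (ℕ →₀ ℚ) →ₗ[ℚ] M} (h : ∀ n, f (pt n) = g (pt n)) : f = g := by
  apply Finsupp.lhom_ext'
  intro n
  ext
  exact h n

/-- The linear form `n ↦ t n ^ k`. -/
noncomputable def powForm (t : ℕ → ℚ) (k : ℕ) : Module.Dual ℚ (ℕ →₀ ℚ) :=
  evalForm fun i => t i ^ k

/-- The scalar part of a full contraction is a minor, here a Vandermonde determinant. If the number
of forms differs from the number of vectors, no scalar part is left. -/
theorem scalarPart_iterContr_powForm (t : ℕ → ℚ) (n : ℕ) (j : ℕ) (U : Finset ℕ)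
    (hU : U ⊆ Finset.range n) :
    scalarPart (iterContr (powForm t) j (wedge pt n U))
      = if U.card = j then diffProd t U else 0 := by
  induction n generalizing j U with
  | zero =>
    rw [Finset.range_zero, Finset.subset_empty] at hU
    subst hU
    rcases j with _ | j
    · simp [iterContr_zero, wedge_zero, diffProd_empty]
    · simp [iterContr_succ', wedge_zero, contr_one]
  | succ n ih =>
    by_cases hn : n ∈ U
    · obtain ⟨U', hU', rfl⟩ : ∃ U', U' ⊆ Finset.range n ∧ U = insert n U' :=
        ⟨U.erase n, by rwa [← Finset.subset_insert_iff, ← Finset.range_add_one],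
          (Finset.insert_erase hn).symm⟩
      have hnU : n ∉ U' := fun h => by simpa using hU' h
      rw [wedge_succ_insert, Finset.card_insert_of_notMem hnU]
      rcases j with _ | j
      · rw [iterContr_zero, scalarPart_mul_ι, if_neg (by omega)]
      -- Subtract `t n` times each power form from the next. All forms but the zeroth then kill `pt
      -- n`, so `pt n` is paired with the zeroth. The others are power forms after scaling `pt i` by
      -- `t i - t n`; the sign from `gradeInvol` turns these factors into `t n - t i`.
      · set g : ℕ → Module.Dual ℚ (ℕ →₀ ℚ) := fun k =>
          if k = 0 then powForm t 0 else evalForm fun i => (t i - t n) * t i ^ (k - 1) with hg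
        have htri := iterContr_triangular g (powForm t) (fun _ => 1) (by
          intro k
          rcases k with _ | k
          · simp [hg]
          · have : g (k + 1) - (1 : ℚ) • powForm t (k + 1) = (-t n) • powForm t k := by
              apply hom_pt_ext
              intro i
              simp [hg, powForm, evalForm_pt]
              ring
            rw [this]
            exact Submodule.smul_mem _ _ (Submodule.subset_span ⟨k, by simp, rfl⟩)) (j + 1)
          (wedge pt n U' * ι ℚ (pt n))
        rw [Finset.prod_const_one, one_smul] at htri
        rw [← htri, iterContr_succ', contr_mul_ι, map_add, map_add, iterContr_mul_ι,
          scalarPart_mul_ι, zero_add, gradeInvol_wedge _ _ _ hU', map_smul, map_smul, map_smul]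
        · have hg0 : g 0 (pt n) = 1 := by simp [hg, powForm, evalForm_pt]
          have hD : (fun k => g (k + 1))
              = fun k => powForm t k ∘ₗ ptMap (fun i => (t i - t n) • pt i) := by
            funext k
            apply hom_pt_ext
            intro i
            simp [hg, powForm, evalForm_pt, ptMap_pt]
          rw [hg0, one_smul, hD, map_smul, ← scalarPart_map (ptMap fun i => (t i - t n) • pt i),
            ← iterContr_map, map_ptMap_wedge, wedge_smul _ _ _ _ hU', map_smul, map_smul,
            ih j U' hU', diffProd_insert t hU']
          by_cases hc : U'.card = j
          · rw [if_pos hc, if_pos (by omega), smul_eq_mul, smul_eq_mul, ← mul_assoc]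
            congr 1
            rw [← Finset.prod_const, ← Finset.prod_mul_distrib]
            exact Finset.prod_congr rfl fun i _ => by ring
          · rw [if_neg hc, if_neg (by omega), smul_zero, smul_zero]
        · intro k
          simp [hg, evalForm_pt]
    · rw [wedge_succ_of_notMem _ hn]
      exact ih j U ((Finset.subset_insert_iff_of_notMem hn).mp (by rwa [← Finset.range_add_one]))

theorem scalarPart_iterContr_of_pow (v : ℕ → M) (f : ℕ → Module.Dual ℚ M) (t : ℕ → ℚ)
    (h : ∀ k i, f k (v i) = t i ^ k) (n j : ℕ) (U : Finset ℕ) (hU : U ⊆ Finset.range n) :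
    scalarPart (iterContr f j (wedge v n U)) = if U.card = j then diffProd t U else 0 := by
  rw [← scalarPart_iterContr_powForm t n j U hU, ← map_ptMap_wedge, iterContr_map, scalarPart_map]
  congr 3
  funext k
  apply hom_pt_ext
  intro i
  simp [ptMap_pt, h, powForm, evalForm_pt]

/-- The factors `(-1) ^ i` make the sign depend only on sizes. Moving `y i` to the right passes the
elements of `S` above `i`, while `i` itself counts the elements of `S` and of its complement below
`i`. Together these are `S.card` plus the rank of `i` in the complement. -/
theorem wedge_add_smul (x y : ℕ → M) (β : ℕ → ℚ) (n : ℕ) :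
    wedge (fun i => x i + ((-1) ^ i * β i) • y i) n (Finset.range n)
      = ∑ S ∈ (Finset.range n).powerset,
          ((-1) ^ (S.card * (Finset.range n \ S).card + (Finset.range n \ S).card.choose 2) *
            ∏ i ∈ Finset.range n \ S, β i) • (wedge x n S * wedge y n (Finset.range n \ S)) := by
  induction n with
  | zero => simp [wedge_zero]
  | succ n ih =>
    rw [Finset.range_add_one, wedge_succ_insert, ih, Finset.sum_powerset_insert (by simp),
      ← Finset.sum_add_distrib, Finset.sum_mul]
    refine Finset.sum_congr rfl fun S hS => ?_
    rw [Finset.mem_powerset] at hS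
    have hn : n ∉ S := fun h => by simpa using hS h
    have hn' : n ∉ Finset.range n \ S := by simp
    have h1 := range_succ_sdiff_insert n S
    rw [Finset.range_add_one] at h1
    have h2 : insert n (Finset.range n) \ S = insert n (Finset.range n \ S) :=
      Finset.insert_sdiff_of_notMem _ hn
    have hcard : S.card + (Finset.range n \ S).card = n := by
      rw [add_comm, Finset.card_sdiff_add_card_eq_card hS, Finset.card_range]
    have key : wedge x n S * wedge y n (Finset.range n \ S) * ι ℚ (x n)
        = (-1 : ℚ) ^ (Finset.range n \ S).card •
          (wedge x n S * ι ℚ (x n) * wedge y n (Finset.range n \ S)) := by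
      rw [mul_assoc, mul_ι_eq, gradeInvol_wedge y n _ Finset.sdiff_subset, mul_smul_comm,
        mul_smul_comm, mul_assoc]
    rw [h1, h2, wedge_succ_insert, wedge_succ_insert, wedge_succ_of_notMem x hn,
      wedge_succ_of_notMem y hn', Finset.card_insert_of_notMem hn,
      Finset.card_insert_of_notMem hn', Finset.prod_insert hn', map_add, map_smul,
      smul_mul_assoc, mul_add, key, mul_smul_comm, smul_add, smul_smul, smul_smul,
      ← mul_assoc (wedge x n S) (wedge y n _)]
    generalize (Finset.range n \ S).card = q at *
    generalize S.card = p at *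
    subst hcard
    refine (add_comm _ _).trans (congrArg₂ (· + ·) ?_ ?_)
    · congr 1
      rw [Nat.choose_succ_succ' q 1, Nat.choose_one_right]
      ring
    · congr 1
      ring

/-- A Laplace expansion, in which the alternating signs have been absorbed. -/
theorem scalarPart_iterContr_iterContr_range (t β : ℕ → ℚ) (p q : ℕ) :
    scalarPart (iterContr (fun k => evalForm fun i => (-1) ^ i * β i * t i ^ k) q
        (iterContr (powForm t) p (wedge pt (p + q) (Finset.range (p + q)))))
      = (-1) ^ (p * q + q.choose 2) * ∑ S ∈ (Finset.range (p + q)).powersetCard p,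
          (∏ i ∈ Finset.range (p + q) \ S, β i) *
            (diffProd t S * diffProd t (Finset.range (p + q) \ S)) := by
  -- Double the space, so that the two families of forms act on separate summands and each term of
  -- the expansion factors.
  let x : ℕ → (ℕ →₀ ℚ) × (ℕ →₀ ℚ) := fun i => (pt i, 0)
  let y : ℕ → (ℕ →₀ ℚ) × (ℕ →₀ ℚ) := fun i => (0, pt i)
  let ψ : (ℕ →₀ ℚ) →ₗ[ℚ] (ℕ →₀ ℚ) × (ℕ →₀ ℚ) := ptMap fun i => x i + ((-1) ^ i * β i) • y i
  let F : ℕ → Module.Dual ℚ ((ℕ →₀ ℚ) × (ℕ →₀ ℚ)) := fun k => powForm t k ∘ₗ LinearMap.fst ℚ _ _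
  let G : ℕ → Module.Dual ℚ ((ℕ →₀ ℚ) × (ℕ →₀ ℚ)) := fun k => powForm t k ∘ₗ LinearMap.snd ℚ _ _
  have hF : powForm t = fun k => F k ∘ₗ ψ := by
    funext k
    apply hom_pt_ext
    intro i
    simp [F, ψ, ptMap_pt, x, y]
  have hG : (fun k => evalForm fun i => (-1) ^ i * β i * t i ^ k) = fun k => G k ∘ₗ ψ := by
    funext k
    apply hom_pt_ext
    intro i
    simp [G, ψ, ptMap_pt, x, y, powForm, evalForm_pt]
  have hterm : ∀ S ⊆ Finset.range (p + q),
      scalarPart (iterContr G q (iterContr F p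
        (wedge x (p + q) S * wedge y (p + q) (Finset.range (p + q) \ S))))
      = if S.card = p then diffProd t S * diffProd t (Finset.range (p + q) \ S) else 0 := by
    intro S hS
    have hcard : (Finset.range (p + q) \ S).card + S.card = p + q := by
      rw [Finset.card_sdiff_add_card_eq_card hS, Finset.card_range]
    rw [scalarPart_iterContr_iterContr_mul, scalarPart_iterContr_of_pow x F t _ _ _ _ hS,
      scalarPart_iterContr_of_pow y G t _ _ _ _ Finset.sdiff_subset]
    · by_cases hp : S.card = p
      · rw [if_pos hp, if_pos hp, if_pos (by omega)]
      · rw [if_neg hp, if_neg hp, zero_mul]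
    · intro k i; simp [G, y, powForm, evalForm_pt]
    · intro k i; simp [F, x, powForm, evalForm_pt]
    · intro k; exact contr_wedge_eq_zero _ _ (fun i => by simp [F, y]) _ _
    · intro k; exact contr_wedge_eq_zero _ _ (fun i => by simp [G, x]) _ _
  rw [hG]
  conv_lhs => rw [hF]
  rw [← scalarPart_map ψ, ← iterContr_map, ← iterContr_map, map_ptMap_wedge, wedge_add_smul,
    map_sum, map_sum, map_sum, Finset.mul_sum, Finset.powersetCard_eq_filter, Finset.sum_filter]
  refine Finset.sum_congr rfl fun S hS => ?_
  rw [Finset.mem_powerset] at hS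
  have hcard : (Finset.range (p + q) \ S).card + S.card = p + q := by
    rw [Finset.card_sdiff_add_card_eq_card hS, Finset.card_range]
  rw [map_smul, map_smul, map_smul, hterm S hS]
  by_cases hp : S.card = p
  · rw [if_pos hp, if_pos hp, hp, show (Finset.range (p + q) \ S).card = q by omega, smul_eq_mul,
      mul_assoc]
  · rw [if_neg hp, if_neg hp, smul_zero]

/-- The sum over all ways of splitting `0, …, p + q - 1` into sets of sizes `p` and `q`. -/
theorem sum_diffProd_mul_diffProd (t : ℕ → ℚ) (p q : ℕ) (hpq : p = q ∨ p = q + 1) :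
    ∑ S ∈ (Finset.range (p + q)).powersetCard p,
        diffProd t S * diffProd t (Finset.range (p + q) \ S)
      = 2 ^ q * diffProd (fun i => t (2 * i)) (Finset.range p) *
          diffProd (fun i => t (2 * i + 1)) (Finset.range q) := by
  set w := iterContr (powForm t) p (wedge pt (p + q) (Finset.range (p + q))) with hw
  have h1 := scalarPart_iterContr_iterContr_range t (fun _ => 1) p q
  have h2 := scalarPart_iterContr_iterContr_range t (fun i => 1 - (-1) ^ i) p q
  rw [← hw] at h1 h2
  set g : ℕ → Module.Dual ℚ (ℕ →₀ ℚ) := fun k => evalForm fun i => (-1) ^ i * 1 * t i ^ k with hg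
  set h : ℕ → Module.Dual ℚ (ℕ →₀ ℚ) :=
    fun k => evalForm fun i => (-1) ^ i * (1 - (-1) ^ i) * t i ^ k with hh
  -- This is `(-1) ^ i = (-1) ^ i * (1 - (-1) ^ i) + 1`. The extra `powForm t k` contracts `w` to
  -- zero for `k < p`, which suffices because `q ≤ p`. So the weights `1` and `1 - (-1) ^ i` give
  -- the same determinant.
  have hgh : ∀ k, g k = h k + powForm t k := by
    intro k
    apply hom_pt_ext
    intro i
    simp only [hg, hh, powForm, LinearMap.add_apply, evalForm_pt]
    rcases neg_one_pow_eq_or ℚ i with e | e <;> rw [e] <;> ring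
  have hiter : ∀ k ≤ p, iterContr g k w = iterContr h k w := by
    intro k
    induction k with
    | zero => intro _; rfl
    | succ k ih =>
      intro hk
      rw [iterContr_succ, ih (by omega), hgh, contr_add, iterContr_succ,
        iterContr_of_contr_eq_zero (powForm t k) h k w (contr_iterContr_of_lt _ hk _), add_zero]
  rw [hiter q (by omega), h2] at h1
  have h3 := mul_left_cancel₀ (pow_ne_zero _ (by norm_num)) h1
  simp only [Finset.prod_const_one, one_mul] at h3
  have hev : StrictMonoOn (fun i : ℕ => 2 * i) (Finset.range p : Set ℕ) :=
    fun i _ j _ hij => by simp only; omega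
  have hod : StrictMonoOn (fun i : ℕ => 2 * i + 1) (Finset.range q : Set ℕ) :=
    fun i _ j _ hij => by simp only; omega
  have hcompl : Finset.range (p + q) \ (Finset.range p).image (fun i => 2 * i)
      = (Finset.range q).image fun i => 2 * i + 1 := by
    ext n
    simp only [Finset.mem_sdiff, Finset.mem_range, Finset.mem_image, not_exists, not_and]
    constructor
    · rintro ⟨h4, h5⟩
      rcases Nat.even_or_odd' n with ⟨m, rfl | rfl⟩
      · exact absurd rfl (h5 m (by omega))
      · exact ⟨m, by omega, rfl⟩
    · rintro ⟨m, hm, rfl⟩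
      exact ⟨by omega, fun k _ => by omega⟩
  have hevsub : (Finset.range p).image (fun i => 2 * i) ⊆ Finset.range (p + q) := by
    intro n
    simp only [Finset.mem_image, Finset.mem_range]
    rintro ⟨m, hm, rfl⟩
    omega
  -- The weight is `0` at even and `2` at odd indices. The complement of `S` has `q` elements and
  -- must lie among the `q` odd indices, so `S` is the set of even ones.
  rw [← h3, Finset.sum_eq_single ((Finset.range p).image fun i => 2 * i), hcompl,
    diffProd_image t _ _ hev, diffProd_image t _ _ hod, Finset.prod_image hod.injOn, mul_assoc]
  · congr 1
    rw [Finset.prod_congr rfl fun i _ => (by rw [pow_succ, pow_mul]; norm_num :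
      (1 - (-1) ^ (2 * i + 1) : ℚ) = 2), Finset.prod_const, Finset.card_range]
  · intro S hS hne
    rw [Finset.mem_powersetCard] at hS
    rw [mul_eq_zero]
    left
    by_contra h0
    rw [← ne_eq, Finset.prod_ne_zero_iff] at h0
    have hcS : (Finset.range (p + q) \ S).card + S.card = p + q := by
      rw [Finset.card_sdiff_add_card_eq_card hS.1, Finset.card_range]
    have hsub : Finset.range (p + q) \ S ⊆ (Finset.range q).image fun i => 2 * i + 1 := by
      intro n hn
      rw [← hcompl, Finset.mem_sdiff]
      refine ⟨(Finset.mem_sdiff.mp hn).1, fun hn' => h0 n hn ?_⟩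
      obtain ⟨m, -, rfl⟩ := Finset.mem_image.mp hn'
      rw [pow_mul]
      norm_num
    have heq := Finset.eq_of_subset_of_card_le hsub (by
      rw [Finset.card_image_of_injOn hod.injOn, Finset.card_range]; omega)
    rw [← hcompl] at heq
    rw [← Finset.sdiff_sdiff_eq_self hS.1, heq, Finset.sdiff_sdiff_eq_self hevsub] at hne
    exact hne rfl
  · intro hmem
    refine absurd ?_ hmem
    rw [Finset.mem_powersetCard]
    exact ⟨hevsub, by rw [Finset.card_image_of_injOn hev.injOn, Finset.card_range]⟩

end Minors

/-! ### Transfer across two neighbouring diagonals -/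

section ZigZag

theorem numTilings_insert_insert {R : Finset (ℤ × ℤ)} {c d : ℤ × ℤ} (hcR : c ∉ R) (hdR : d ∉ R)
    (hcd : SqAdj c d) (h : ∀ e ∈ R, ¬ SqAdj c e) :
    numTilings (insert c (insert d R)) = numTilings R := by
  have hc : c ∉ insert d R := by simp [hcR, hcd.ne]
  rw [numTilings_forced (c := c) (d := d) (by simp) (by simp) hcd, Finset.erase_insert hc,
    Finset.erase_insert hdR]
  intro e he hce
  simp only [Finset.mem_insert] at he
  rcases he with rfl | rfl | he
  · exact absurd rfl hce.ne
  · rfl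
  · exact absurd hce (h e he)

theorem numTilings_cut_image (A B : Finset (ℤ × ℤ)) (I : Finset ℕ) (f : ℕ → ℤ × ℤ)
    (hf : Function.Injective f) (hA : ∀ i ∈ I, f i ∉ A) (hB : ∀ i ∈ I, f i ∉ B)
    (hAB : Disjoint A B) (hI : ∀ i ∈ I, ∀ j ∈ I, ¬ SqAdj (f i) (f j))
    (hadj : ∀ c ∈ A, ∀ d ∈ B, ¬ SqAdj c d) :
    numTilings (A ∪ I.image f ∪ B)
      = ∑ S ∈ I.powerset, numTilings (A ∪ S.image f) * numTilings (B ∪ (I \ S).image f) := by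
  rw [numTilings_cut A (I.image f) B, Finset.powerset_image, Finset.sum_image]
  · refine Finset.sum_congr rfl fun S _ => ?_
    rw [Finset.image_sdiff _ _ hf]
  · exact (Finset.image_injective hf).injOn
  · rw [Finset.disjoint_right]
    simpa using hA
  · exact hAB
  · rw [Finset.disjoint_left]
    simpa using hB
  · simpa using hI
  · exact hadj

/-- Two sequences of squares in which `w i` is adjacent exactly to `β i` and `β (i + 1)`. -/
structure ZigZag (w β : ℕ → ℤ × ℤ) : Prop where
  injL : Function.Injective w
  injR : Function.Injective β
  ne : ∀ i j, w i ≠ β j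
  adj : ∀ i j, SqAdj (w i) (β j) ↔ j = i ∨ j = i + 1
  adjL : ∀ i j, ¬ SqAdj (w i) (w j)
  adjR : ∀ i j, ¬ SqAdj (β i) (β j)

variable {w β : ℕ → ℤ × ℤ}

/-- The number of tilings of the squares `w i`, `i ∈ E`, and `β j`, `j ∈ Y`. -/
def zigzagTilings (w β : ℕ → ℤ × ℤ) (E Y : Finset ℕ) : ℕ := numTilings (E.image w ∪ Y.image β)

theorem zigzagTilings_empty : zigzagTilings w β ∅ ∅ = 1 := by
  simp [zigzagTilings, numTilings_empty]

theorem ZigZag.tilings_right_eq_zero (h : ZigZag w β) {E Y : Finset ℕ} {n : ℕ} (hn : n ∈ Y)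
    (h1 : n ∉ E) (h2 : ∀ m, n = m + 1 → m ∉ E) : zigzagTilings w β E Y = 0 := by
  refine numTilings_eq_zero (c := β n)
    (Finset.mem_union_right _ (Finset.mem_image_of_mem _ hn)) fun d hd hnd => ?_
  rw [Finset.mem_union, Finset.mem_image, Finset.mem_image] at hd
  rcases hd with ⟨i, hi, rfl⟩ | ⟨i, hi, rfl⟩
  · rcases (h.adj i n).mp hnd.symm with rfl | hin
    · exact h1 hi
    · exact h2 i hin hi
  · exact h.adjR _ _ hnd

theorem ZigZag.tilings_left_eq_zero (h : ZigZag w β) {E Y : Finset ℕ} {n : ℕ} (hn : n ∈ E)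
    (h1 : n ∉ Y) (h2 : n + 1 ∉ Y) : zigzagTilings w β E Y = 0 := by
  refine numTilings_eq_zero (c := w n)
    (Finset.mem_union_left _ (Finset.mem_image_of_mem _ hn)) fun d hd hnd => ?_
  rw [Finset.mem_union, Finset.mem_image, Finset.mem_image] at hd
  rcases hd with ⟨i, hi, rfl⟩ | ⟨i, hi, rfl⟩
  · exact h.adjL _ _ hnd
  · rcases (h.adj n i).mp hnd with rfl | rfl
    · exact h1 hi
    · exact h2 hi

theorem ZigZag.tilings_insert_insert_succ (h : ZigZag w β) {E Y : Finset ℕ} {n : ℕ}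
    (hE : E ⊆ Finset.range n) (hY : Y ⊆ Finset.range (n + 1)) :
    zigzagTilings w β (insert n E) (insert (n + 1) Y) = zigzagTilings w β E Y := by
  have hnE : n ∉ E := fun h => by simpa using hE h
  have hnE' : n + 1 ∉ E := fun h => by simpa using hE h
  have hnY : n + 1 ∉ Y := fun h => by simpa using hY h
  unfold zigzagTilings
  rw [Finset.image_insert, Finset.image_insert, Finset.insert_union, Finset.union_insert,
    Finset.insert_comm]
  refine numTilings_insert_insert ?_ ?_ ((h.adj _ _).mpr (Or.inr rfl)).symm ?_
  · simp only [Finset.mem_union, Finset.mem_image, not_or, not_exists, not_and]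
    exact ⟨fun i _ => h.ne _ _, fun i hi hi' => hnY (h.injR hi' ▸ hi)⟩
  · simp only [Finset.mem_union, Finset.mem_image, not_or, not_exists, not_and]
    exact ⟨fun i hi hi' => hnE (h.injL hi' ▸ hi), fun i _ => (h.ne _ _).symm⟩
  · intro e he hadj
    rw [Finset.mem_union, Finset.mem_image, Finset.mem_image] at he
    rcases he with ⟨i, hi, rfl⟩ | ⟨i, hi, rfl⟩
    · rcases (h.adj _ _).mp hadj.symm with h' | h'
      · exact hnE' (h' ▸ hi)
      · exact hnE ((Nat.succ_injective h') ▸ hi)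
    · exact h.adjR _ _ hadj

theorem ZigZag.tilings_insert_insert (h : ZigZag w β) {E Y : Finset ℕ} {n : ℕ}
    (hE : E ⊆ Finset.range n) (hY : Y ⊆ Finset.range n) :
    zigzagTilings w β (insert n E) (insert n Y) = zigzagTilings w β E Y := by
  have hnE : n ∉ E := fun h => by simpa using hE h
  have hnY : n ∉ Y := fun h => by simpa using hY h
  have hnY' : n + 1 ∉ Y := fun h => by simpa using hY h
  unfold zigzagTilings
  rw [Finset.image_insert, Finset.image_insert, Finset.insert_union, Finset.union_insert]
  refine numTilings_insert_insert ?_ ?_ ((h.adj _ _).mpr (Or.inl rfl)) ?_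
  · simp only [Finset.mem_union, Finset.mem_image, not_or, not_exists, not_and]
    exact ⟨fun i hi hi' => hnE (h.injL hi' ▸ hi), fun i _ => (h.ne _ _).symm⟩
  · simp only [Finset.mem_union, Finset.mem_image, not_or, not_exists, not_and]
    exact ⟨fun i _ => h.ne _ _, fun i hi hi' => hnY (h.injR hi' ▸ hi)⟩
  · intro e he hadj
    rw [Finset.mem_union, Finset.mem_image, Finset.mem_image] at he
    rcases he with ⟨i, hi, rfl⟩ | ⟨i, hi, rfl⟩
    · exact h.adjL _ _ hadj
    · rcases (h.adj _ _).mp hadj with h' | h'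
      · exact hnY (h' ▸ hi)
      · exact hnY' (h' ▸ hi)

open ExteriorAlgebra

theorem subset_range_or_insert {n : ℕ} {E : Finset ℕ} (hE : E ⊆ Finset.range (n + 1)) :
    E ⊆ Finset.range n ∨ ∃ E', E' ⊆ Finset.range n ∧ E = insert n E' := by
  by_cases hn : n ∈ E
  · exact Or.inr ⟨E.erase n, by rwa [← Finset.subset_insert_iff, ← Finset.range_add_one],
      (Finset.insert_erase hn).symm⟩
  · exact Or.inl ((Finset.subset_insert_iff_of_notMem hn).mp (by rwa [← Finset.range_add_one]))

theorem wedge_succ_of_subset {M : Type*} [AddCommGroup M] [Module ℚ M] (v : ℕ → M) {n : ℕ}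
    {U : Finset ℕ} (hU : U ⊆ Finset.range n) : wedge v (n + 1) U = wedge v n U :=
  wedge_succ_of_notMem v fun h => by simpa using hU h

theorem wedge_mul_ι_of_mem {M : Type*} [AddCommGroup M] [Module ℚ M] (v : ℕ → M) {n : ℕ}
    {U : Finset ℕ} (hU : n ∈ U) : wedge v (n + 1) U * ι ℚ (v n) = 0 := by
  rw [wedge_succ_of_mem v hU, mul_assoc, ι_sq_zero, mul_zero]

/-- Summing over all ways to match the squares `w i`, `i ∈ E`. -/
theorem ZigZag.sum_right (h : ZigZag w β) (n : ℕ) (E : Finset ℕ) (hE : E ⊆ Finset.range n) :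
    ∑ Y ∈ (Finset.range (n + 1)).powerset, (zigzagTilings w β E Y : ℚ) • wedge pt (n + 1) Y
      = wedge (fun i => pt i + pt (i + 1)) n E := by
  induction n generalizing E with
  | zero =>
    rw [Finset.range_zero, Finset.subset_empty] at hE
    subst hE
    rw [Finset.range_one, show ({0} : Finset ℕ) = insert 0 ∅ from rfl,
      Finset.sum_powerset_insert (by simp), Finset.powerset_empty, Finset.sum_singleton,
      Finset.sum_singleton, zigzagTilings_empty,
      h.tilings_right_eq_zero (n := 0) (by simp) (by simp) (by simp)]
    simp [wedge]
  | succ n ih =>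
    rw [Finset.range_add_one, Finset.sum_powerset_insert (by simp)]
    rcases subset_range_or_insert hE with hE | ⟨E, hE', rfl⟩
    -- Without `w n`, the square `β (n + 1)` has no neighbour and cannot occur.
    · have hn : n ∉ E := fun h => by simpa using hE h
      have hn' : n + 1 ∉ E := fun h => by simpa using hE h
      rw [wedge_succ_of_subset _ hE, ← ih E hE, Finset.sum_eq_zero (s := Finset.powerset _)
        (f := fun Y => (zigzagTilings w β E (insert (n + 1) Y) : ℚ) • _), add_zero]
      · refine Finset.sum_congr rfl fun Y hY => ?_
        rw [wedge_succ_of_subset _ (Finset.mem_powerset.mp hY)]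
      · intro Y hY
        rw [h.tilings_right_eq_zero (n := n + 1) (by simp) hn' (by
          intro m hm; obtain rfl := Nat.succ_injective hm; exact hn), Nat.cast_zero, zero_smul]
    -- The summands `pt n` and `pt (n + 1)` record whether `w n` is matched to `β n` or to `β (n +
    -- 1)`; if `β n` is already in use, the wedge vanishes. Indices stay in increasing order, so no
    -- sign arises.
    · rw [wedge_succ_insert, map_add, mul_add, ← ih E hE', Finset.sum_mul, Finset.sum_mul]
      congr 1
      · rw [Finset.range_add_one, Finset.sum_powerset_insert (by simp),
          Finset.sum_powerset_insert (by simp)]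
        have hz : ∀ Y ∈ (Finset.range n).powerset,
            ((zigzagTilings w β (insert n E) Y : ℕ) : ℚ) = 0 := by
          intro Y hY
          rw [Finset.mem_powerset] at hY
          rw [h.tilings_left_eq_zero (n := n) (by simp) (fun h => by simpa using hY h)
            (fun h => by simpa using hY h), Nat.cast_zero]
        rw [Finset.sum_congr rfl fun Y hY => by rw [hz Y hY, zero_smul], Finset.sum_const_zero,
          zero_add, eq_comm, add_comm, Finset.sum_eq_zero (s := Finset.powerset _)
          (f := fun Y => _ • wedge pt (n + 1) (insert n Y) * _), zero_add]
        · refine Finset.sum_congr rfl fun Y hY => ?_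
          rw [Finset.mem_powerset] at hY
          rw [h.tilings_insert_insert hE' hY, smul_mul_assoc, wedge_succ_of_subset _ hY,
            wedge_succ_of_subset (n := n + 1), wedge_succ_insert]
          rw [Finset.range_add_one]
          exact Finset.insert_subset_insert _ hY
        · intro Y _
          rw [smul_mul_assoc, wedge_mul_ι_of_mem _ (by simp), smul_zero]
      · refine Finset.sum_congr rfl fun Y hY => ?_
        rw [Finset.mem_powerset] at hY
        rw [h.tilings_insert_insert_succ hE' hY, wedge_succ_insert, smul_mul_assoc]

/-- Summing over all ways to match the squares `β j`, `j ∉ U`. -/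
theorem ZigZag.sum_left (h : ZigZag w β) (n : ℕ) (U : Finset ℕ) (hU : U ⊆ Finset.range (n + 1)) :
    ∑ E ∈ (Finset.range n).powerset,
        (zigzagTilings w β (Finset.range n \ E) (Finset.range (n + 1) \ U) : ℚ) •
          wedge (fun i => pt (i + 1) - pt i) n E
      = contr (evalForm fun _ => 1) (wedge pt (n + 1) U) := by
  induction n generalizing U with
  | zero =>
    rw [Finset.range_zero, Finset.powerset_empty, Finset.sum_singleton, wedge_zero]
    rcases subset_range_or_insert hU with hU | ⟨U, hU', rfl⟩
    · rw [wedge_succ_of_subset _ hU, wedge_zero, contr_one,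
        h.tilings_right_eq_zero (n := 0), Nat.cast_zero, zero_smul]
      · rw [Finset.mem_sdiff]
        exact ⟨by simp, fun h => by simpa using hU h⟩
      · simp
      · simp
    · rw [Finset.range_zero, Finset.subset_empty] at hU'
      subst hU'
      rw [wedge_succ_insert, wedge_zero, contr_mul_ι, contr_one, zero_mul, zero_add, evalForm_pt]
      simp [zigzagTilings_empty]
  | succ n ih =>
    rw [Finset.range_add_one (n := n), Finset.sum_powerset_insert (by simp)]
    rcases subset_range_or_insert hU with hU | ⟨U, hU', rfl⟩
    -- Here `β (n + 1)` is present, and its only possible partner is `w n`; hence `n ∉ E`.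
    · have hcompl : Finset.range (n + 1 + 1) \ U = insert (n + 1) (Finset.range (n + 1) \ U) := by
        rw [Finset.range_add_one, Finset.insert_sdiff_of_notMem]
        exact fun h => by simpa using hU h
      rw [wedge_succ_of_subset _ hU, ← ih U hU, hcompl,
        Finset.sum_eq_zero (s := Finset.powerset _)
          (f := fun E => (zigzagTilings w β (_ \ insert n E) _ : ℚ) • _), add_zero]
      · refine Finset.sum_congr rfl fun E hE => ?_
        rw [Finset.mem_powerset] at hE
        rw [wedge_succ_of_subset _ hE, Finset.insert_sdiff_of_notMem _
          (fun h => by simpa using hE h),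
          h.tilings_insert_insert_succ Finset.sdiff_subset Finset.sdiff_subset]
      · intro E hE
        rw [h.tilings_right_eq_zero (n := n + 1) (by simp) (by simp) (by
          intro m hm; obtain rfl := Nat.succ_injective hm; simp), Nat.cast_zero, zero_smul]
    -- Here `β (n + 1)` is missing. The summand `pt n` is the case where `w n` is present and forced
    -- onto `β n`. The summand `pt (n + 1) - pt n` is the case `n ∈ E`; the all-ones form kills it,
    -- so it leaves the contraction as a factor.
    · have hsplit : wedge pt (n + 1) U * ι ℚ (pt (n + 1))
          = wedge pt (n + 1) U * ι ℚ (pt n) + wedge pt (n + 1) U * ι ℚ (pt (n + 1) - pt n) := by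
        rw [map_sub, mul_sub]; abel
      rw [wedge_succ_insert, hsplit, map_add, range_succ_sdiff_insert,
        contr_mul_ι _ _ (pt (n + 1) - pt n), map_sub (evalForm _), evalForm_pt, evalForm_pt,
        sub_self, zero_smul, add_zero, ← ih U hU', Finset.sum_mul]
      congr 1
      · by_cases hn : n ∈ U
        · rw [wedge_mul_ι_of_mem _ hn, map_zero]
          refine Finset.sum_eq_zero fun E hE => ?_
          rw [Finset.mem_powerset] at hE
          rw [h.tilings_left_eq_zero (n := n), Nat.cast_zero, zero_smul]
          · rw [Finset.mem_sdiff]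
            exact ⟨by simp, fun h => by simpa using hE h⟩
          · simp [hn]
          · simp
        · have hUn : U ⊆ Finset.range n :=
            (Finset.subset_insert_iff_of_notMem hn).mp (by rwa [← Finset.range_add_one])
          rw [wedge_succ_of_subset _ hUn, ← wedge_succ_insert, ← ih (insert n U) (by
            rw [Finset.range_add_one]; exact Finset.insert_subset_insert _ hUn)]
          refine Finset.sum_congr rfl fun E hE => ?_
          rw [Finset.mem_powerset] at hE
          have hc : Finset.range (n + 1) \ U = insert n (Finset.range n \ U) := by
            rw [Finset.range_add_one, Finset.insert_sdiff_of_notMem _ hn]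
          rw [wedge_succ_of_subset _ hE, Finset.insert_sdiff_of_notMem _
            (fun h => by simpa using hE h), hc, range_succ_sdiff_insert,
            h.tilings_insert_insert Finset.sdiff_subset Finset.sdiff_subset]
      · refine Finset.sum_congr rfl fun E hE => ?_
        rw [Finset.mem_powerset] at hE
        rw [← Finset.range_add_one, range_succ_sdiff_insert, wedge_succ_insert, smul_mul_assoc]

end ZigZag

/-! ### Tilings of a half region with missing squares on its boundary diagonal -/

section HalfRegion

open ExteriorAlgebra

/-- The `i`-th square on the diagonal starting at `p`. -/
def diagCell (p : ℤ × ℤ) (i : ℕ) : ℤ × ℤ := (p.1 + i, p.2 + i)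

theorem diagCell_injective (p : ℤ × ℤ) : Function.Injective (diagCell p) := by
  intro i j h
  simp only [diagCell, Prod.mk.injEq] at h
  omega

theorem not_sqAdj_diagCell (p : ℤ × ℤ) (i j : ℕ) : ¬ SqAdj (diagCell p i) (diagCell p j) := by
  simp only [SqAdj, diagCell]; omega

theorem zigZag_above (p : ℤ × ℤ) : ZigZag (diagCell (p.1, p.2 + 1)) (diagCell p) where
  injL := diagCell_injective _
  injR := diagCell_injective _
  ne i j := by simp only [diagCell, ne_eq, Prod.mk.injEq]; omega
  adj i j := by simp only [SqAdj, diagCell]; omega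
  adjL := not_sqAdj_diagCell _
  adjR := not_sqAdj_diagCell _

theorem zigZag_below (p : ℤ × ℤ) :
    ZigZag (diagCell (p.1, p.2 + 1)) (diagCell (p.1 - 1, p.2 + 1)) where
  injL := diagCell_injective _
  injR := diagCell_injective _
  ne i j := by simp only [diagCell, ne_eq, Prod.mk.injEq]; omega
  adj i j := by simp only [SqAdj, diagCell]; omega
  adjL := not_sqAdj_diagCell _
  adjR := not_sqAdj_diagCell _

/-- The `2 * n + 1` diagonals above the diagonal through `p`, alternately of length `a` and
`a + 1`. -/
def upperRows (a : ℕ) : ℕ → ℤ × ℤ → Finset (ℤ × ℤ)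
  | 0, p => (Finset.range a).image (diagCell (p.1, p.2 + 1))
  | n + 1, p => upperRows a n (p.1 - 1, p.2 + 1) ∪
      (Finset.range (a + 1)).image (diagCell (p.1 - 1, p.2 + 1)) ∪
      (Finset.range a).image (diagCell (p.1, p.2 + 1))

theorem mem_image_diagCell {p c : ℤ × ℤ} {a : ℕ} : c ∈ (Finset.range a).image (diagCell p) ↔
    c.2 - c.1 = p.2 - p.1 ∧ p.1 ≤ c.1 ∧ c.1 < p.1 + a := by
  simp only [Finset.mem_image, Finset.mem_range, diagCell]
  constructor
  · rintro ⟨i, hi, rfl⟩; simp only; omega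
  · rintro ⟨h1, h2, h3⟩
    exact ⟨(c.1 - p.1).toNat, by omega, by ext <;> simp only <;> omega⟩

theorem mem_upperRows {a n : ℕ} {p c : ℤ × ℤ} : c ∈ upperRows a n p ↔
    1 ≤ (c.2 - p.2) - (c.1 - p.1) ∧ (c.2 - p.2) - (c.1 - p.1) ≤ 2 * n + 1 ∧
      0 ≤ (c.1 - p.1) + (c.2 - p.2) ∧ (c.1 - p.1) + (c.2 - p.2) ≤ 2 * a := by
  induction n generalizing p with
  | zero =>
    rw [upperRows, mem_image_diagCell]
    simp only
    omega
  | succ n ih =>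
    rw [upperRows, Finset.mem_union, Finset.mem_union, ih, mem_image_diagCell, mem_image_diagCell]
    simp only
    push_cast
    omega

theorem diag_of_mem_image {p c : ℤ × ℤ} {I : Finset ℕ} (h : c ∈ I.image (diagCell p)) :
    c.2 - c.1 = p.2 - p.1 := by
  obtain ⟨i, -, rfl⟩ := Finset.mem_image.mp h
  simp only [diagCell]
  omega

theorem SqAdj.diag {c d : ℤ × ℤ} (h : SqAdj c d) :
    d.2 - d.1 = c.2 - c.1 + 1 ∨ d.2 - d.1 = c.2 - c.1 - 1 := by
  unfold SqAdj at h; omega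

/-- Cutting a region along the diagonal through `p`. -/
theorem numTilings_cut_diag (A B : Finset (ℤ × ℤ)) (p : ℤ × ℤ) (I : Finset ℕ)
    (hA : ∀ c ∈ A, p.2 - p.1 < c.2 - c.1) (hB : ∀ c ∈ B, c.2 - c.1 < p.2 - p.1) :
    numTilings (A ∪ I.image (diagCell p) ∪ B)
      = ∑ S ∈ I.powerset, numTilings (A ∪ S.image (diagCell p)) *
          numTilings (B ∪ (I \ S).image (diagCell p)) := by
  refine numTilings_cut_image A B I _ (diagCell_injective p) ?_ ?_ ?_
    (fun i _ j _ => not_sqAdj_diagCell p i j) ?_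
  · intro i _ h
    have := hA _ h
    simp only [diagCell] at this
    omega
  · intro i _ h
    have := hB _ h
    simp only [diagCell] at this
    omega
  · rw [Finset.disjoint_left]
    intro c hc hc'
    have := hA c hc
    have := hB c hc'
    omega
  · intro c hc d hd h
    have := hA c hc
    have := hB d hd
    have := h.diag
    omega

/-- Adding the two diagonals below a region changes the number of tilings linearly. -/
theorem numTilings_add_two_rows (a : ℕ) (p : ℤ × ℤ) (A : Finset (ℤ × ℤ))
    (hA : ∀ c ∈ A, p.2 - p.1 + 1 < c.2 - c.1) (L : ExteriorAlgebra ℚ (ℕ →₀ ℚ) →ₗ[ℚ] ℚ)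
    (hL : ∀ E ⊆ Finset.range a, (numTilings (A ∪ E.image (diagCell (p.1, p.2 + 1))) : ℚ)
      = L (wedge (fun i => pt (i + 1) - pt i) a E))
    (U : Finset ℕ) (hU : U ⊆ Finset.range (a + 1)) :
    (numTilings (A ∪ (Finset.range a).image (diagCell (p.1, p.2 + 1)) ∪
        (Finset.range (a + 1) \ U).image (diagCell p)) : ℚ)
      = L (contr (evalForm fun _ => 1) (wedge pt (a + 1) U)) := by
  rw [numTilings_cut_diag A _ (p.1, p.2 + 1) (Finset.range a), ← (zigZag_above p).sum_left a U hU,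
    map_sum, Nat.cast_sum]
  · refine Finset.sum_congr rfl fun E hE => ?_
    rw [map_smul, ← hL E (Finset.mem_powerset.mp hE), Nat.cast_mul, smul_eq_mul, mul_comm,
      zigzagTilings, Finset.union_comm (Finset.image (diagCell p) _)]
  · intro c hc
    have := hA c hc
    simp only
    omega
  · intro c hc
    have := diag_of_mem_image hc
    simp only
    omega

/-- The sum `∑ i < x, (i ^ k + (i + 1) ^ k)`, as a function of `x`. -/
def trapezoidSum (k x : ℕ) : ℚ := ∑ i ∈ Finset.range x, ((i : ℚ) ^ k + ((i + 1 : ℕ) : ℚ) ^ k)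

theorem trapezoidSum_eq (k x : ℕ) :
    trapezoidSum k x = 2 * (∑ i ∈ Finset.range x, (i : ℚ) ^ k) + (x : ℚ) ^ k - 0 ^ k := by
  induction x with
  | zero => simp [trapezoidSum]
  | succ x ih =>
    rw [trapezoidSum, Finset.sum_range_succ, ← trapezoidSum, ih, Finset.sum_range_succ]
    ring

/-- Faulhaber's formula: the sum is a polynomial in `x` of degree `k + 1` whose leading coefficient
`2 / (k + 1)` comes from the zeroth Bernoulli number. -/
theorem evalForm_trapezoidSum_sub_mem_span (k : ℕ) :
    evalForm (trapezoidSum k) - (2 / (k + 1) : ℚ) • powForm Nat.cast (k + 1)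
      ∈ Submodule.span ℚ (powForm Nat.cast '' Set.Iio (k + 1)) := by
  have h : evalForm (trapezoidSum k) - (2 / (k + 1) : ℚ) • powForm Nat.cast (k + 1)
      = (∑ i ∈ Finset.range k,
          (2 * (bernoulli (i + 1) * ((k + 1).choose (i + 1)) / (k + 1))) •
            powForm Nat.cast (k - i)) + powForm Nat.cast k - (0 ^ k : ℚ) • powForm Nat.cast 0 := by
    apply hom_pt_ext
    intro x
    simp only [LinearMap.sub_apply, LinearMap.add_apply, LinearMap.smul_apply,
      LinearMap.sum_apply, powForm, evalForm_pt, trapezoidSum_eq, sum_range_pow, smul_eq_mul]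
    rw [Finset.sum_range_succ', bernoulli_zero]
    simp only [Nat.choose_zero_right, Nat.sub_zero, Nat.cast_one, Nat.add_sub_add_right, pow_zero,
      mul_one, one_mul]
    rw [mul_add, Finset.mul_sum]
    have : ∀ i ∈ Finset.range k, 2 * (bernoulli (i + 1) * ((k + 1).choose (i + 1)) *
        (x : ℚ) ^ (k - i) / (k + 1)) = 2 * (bernoulli (i + 1) * ((k + 1).choose (i + 1)) / (k + 1))
          * (x : ℚ) ^ (k - i) := fun i _ => by ring
    rw [Finset.sum_congr rfl this]
    ring
  have hmem : ∀ i < k + 1, powForm Nat.cast i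
      ∈ Submodule.span ℚ (powForm Nat.cast '' Set.Iio (k + 1)) :=
    fun i hi => Submodule.subset_span ⟨i, hi, rfl⟩
  rw [h]
  refine Submodule.sub_mem _ (Submodule.add_mem _ (Submodule.sum_mem _ fun i _ => ?_)
    (hmem k (by omega))) (Submodule.smul_mem _ _ (hmem 0 (by omega)))
  exact Submodule.smul_mem _ _ (hmem _ (by omega))

/-- The constant in the number of tilings of a half of the region. -/
def halfConst (n : ℕ) : ℚ := ∏ m ∈ Finset.range n, ∏ k ∈ Finset.range (m + 1), (2 / (k + 1) : ℚ)

theorem halfConst_succ (n : ℕ) :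
    halfConst (n + 1) = halfConst n * ∏ k ∈ Finset.range (n + 1), (2 / (k + 1) : ℚ) :=
  Finset.prod_range_succ _ _

/-- Induction on pairs of diagonals. Each pair adds one contraction with the all-ones form and
raises the degree of the forms already present by one. -/
theorem numTilings_half_aux (a n : ℕ) (p : ℤ × ℤ) (U : Finset ℕ)
    (hU : U ⊆ Finset.range (a + 1)) :
    (numTilings (upperRows a n p ∪ (Finset.range (a + 1) \ U).image (diagCell p)) : ℚ)
      = halfConst n * scalarPart (iterContr (powForm Nat.cast) (n + 1) (wedge pt (a + 1) U)) := by
  have h1 : (powForm Nat.cast 0) = evalForm fun _ => 1 := by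
    apply hom_pt_ext; intro i; simp [powForm]
  induction n generalizing p U with
  | zero =>
    -- With nothing above, the squares of `E` cannot be covered, so the count is `1` for empty `E`
    -- and `0` otherwise, which is the scalar part.
    have := numTilings_add_two_rows a p ∅ (by simp) scalarPart.toLinearMap (by
      intro E hE
      rw [← map_ptMap_wedge, AlgHom.toLinearMap_apply, scalarPart_map]
      have := scalarPart_iterContr_powForm (fun i => (i : ℚ)) a 0 E hE
      rw [iterContr_zero] at this
      rw [this, Finset.empty_union]
      rcases E.eq_empty_or_nonempty with rfl | ⟨i, hi⟩
      · simp [numTilings_empty, diffProd_empty]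
      · rw [if_neg (Finset.card_ne_zero_of_mem hi), numTilings_eq_zero
          (Finset.mem_image_of_mem _ hi), Nat.cast_zero]
        intro d hd
        obtain ⟨j, -, rfl⟩ := Finset.mem_image.mp hd
        exact not_sqAdj_diagCell _ _ _) U hU
    rw [Finset.empty_union] at this
    rw [upperRows, this, ← h1]
    simp [halfConst, iterContr_succ, iterContr_zero]
  | succ n ih =>
    let S : ℕ → Module.Dual ℚ (ℕ →₀ ℚ) := fun k => evalForm (trapezoidSum k)
    have key := numTilings_add_two_rows a p
      (upperRows a n (p.1 - 1, p.2 + 1) ∪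
        (Finset.range (a + 1)).image (diagCell (p.1 - 1, p.2 + 1))) (by
      intro c hc
      rw [Finset.mem_union, mem_upperRows] at hc
      rcases hc with hc | hc
      · simp only at hc; omega
      · have := diag_of_mem_image hc
        simp only at this; omega) (halfConst n • (scalarPart.toLinearMap ∘ₗ iterContr S (n + 1)))
      (by
      intro E hE
      rw [numTilings_cut_diag _ _ (p.1 - 1, p.2 + 1), Nat.cast_sum]
      · have hE' := (zigZag_below p).sum_right a E hE
        -- The sums `S k` are discrete antiderivatives: on differences of basis vectors they do what
        -- the powers do on sums of neighbours.
        have hS : (fun k => S k ∘ₗ ptMap fun i => pt (i + 1) - pt i)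
            = fun k => powForm Nat.cast k ∘ₗ ptMap fun i => pt i + pt (i + 1) := by
          funext k
          apply hom_pt_ext
          intro i
          simp only [S, LinearMap.comp_apply, ptMap_pt, map_sub, map_add, evalForm_pt, powForm]
          rw [trapezoidSum, Finset.sum_range_succ, trapezoidSum]
          ring
        rw [← map_ptMap_wedge, LinearMap.smul_apply, LinearMap.comp_apply,
          AlgHom.toLinearMap_apply, iterContr_map, scalarPart_map, hS,
          ← scalarPart_map (ptMap fun i => pt i + pt (i + 1)), ← iterContr_map, map_ptMap_wedge,
          ← hE', map_sum, map_sum, Finset.smul_sum]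
        -- The cut indexes squares matched upwards, the induction hypothesis squares missing from
        -- the upper part; the two are complementary.
        refine Finset.sum_nbij' (fun T => Finset.range (a + 1) \ T)
          (fun T => Finset.range (a + 1) \ T) (fun T _ => by simp) (fun T _ => by simp)
          (fun T hT => Finset.sdiff_sdiff_eq_self (Finset.mem_powerset.mp hT))
          (fun T hT => Finset.sdiff_sdiff_eq_self (Finset.mem_powerset.mp hT)) fun T hT => ?_
        have := ih (p.1 - 1, p.2 + 1) (Finset.range (a + 1) \ T) Finset.sdiff_subset
        rw [Finset.sdiff_sdiff_eq_self (Finset.mem_powerset.mp hT)] at this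
        rw [Nat.cast_mul, this, map_smul, map_smul, smul_eq_mul, smul_eq_mul, zigzagTilings]
        ring
      · intro c hc
        rw [mem_upperRows] at hc
        simp only at hc ⊢
        omega
      · intro c hc
        have := diag_of_mem_image hc
        simp only at this ⊢
        omega) U hU
    rw [upperRows, key, LinearMap.smul_apply, LinearMap.comp_apply, AlgHom.toLinearMap_apply,
      ← h1]
    -- The sequence `1, S 0, S 1, …` has a polynomial of degree `k` in place `k`, with leading
    -- coefficient `2 / k` for `k > 0`, and so is triangular against the powers.
    let S' : ℕ → Module.Dual ℚ (ℕ →₀ ℚ) := fun k => if k = 0 then powForm Nat.cast 0 else S (k - 1)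
    have hS' := iterContr_triangular S' (powForm Nat.cast) (fun k => if k = 0 then 1 else 2 / k)
      (by
        intro k
        rcases k with _ | k
        · simp [S']
        · have := evalForm_trapezoidSum_sub_mem_span k
          simpa [S', S] using this) (n + 2) (wedge pt (a + 1) U)
    rw [iterContr_succ'] at hS'
    have e1 : (fun k => S' (k + 1)) = S := by funext k; simp [S']
    have e2 : S' 0 = powForm Nat.cast 0 := by simp [S']
    rw [e1, e2] at hS'
    have hprod : ∏ k ∈ Finset.range (n + 1), (if k + 1 = 0 then (1 : ℚ) else 2 / (k + 1 : ℕ))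
        = ∏ k ∈ Finset.range (n + 1), (2 / (k + 1) : ℚ) :=
      Finset.prod_congr rfl fun k _ => by simp
    rw [hS', map_smul, Finset.prod_range_succ', hprod, if_pos rfl, mul_one, halfConst_succ,
      smul_eq_mul, smul_eq_mul, mul_assoc]

theorem halfConst_eq (n : ℕ) : halfConst n = 2 ^ (n * (n + 1) / 2) / (n.superFactorial : ℚ) := by
  have h1 : ∀ m : ℕ, ∏ k ∈ Finset.range m, (2 / (k + 1) : ℚ) = 2 ^ m / (m.factorial : ℚ) := by
    intro m
    rw [Finset.prod_div_distrib, Finset.prod_const, Finset.card_range,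
      ← Finset.prod_range_add_one_eq_factorial]
    push_cast
    rfl
  induction n with
  | zero => simp [halfConst]
  | succ n ih =>
    rw [halfConst_succ, ih, h1, Nat.superFactorial_succ, Nat.cast_mul, div_mul_div_comm, ← pow_add,
      mul_comm (n.superFactorial : ℚ), show (n + 1) * (n + 1 + 1) = n * (n + 1) + (n + 1) * 2 by ring,
      Nat.add_mul_div_right _ _ two_pos]

/-- The number of tilings of a half of the region, with the squares in `U` missing on the
bounding diagonal. -/
theorem numTilings_half (a n : ℕ) (p : ℤ × ℤ) (U : Finset ℕ) (hU : U ⊆ Finset.range (a + 1)) :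
    (numTilings (upperRows a n p ∪ (Finset.range (a + 1) \ U).image (diagCell p)) : ℚ)
      = 2 ^ (n * (n + 1) / 2) / (n.superFactorial : ℚ) *
        if U.card = n + 1 then diffProd Nat.cast U else 0 := by
  rw [numTilings_half_aux a n p U hU, halfConst_eq, scalarPart_iterContr_powForm _ _ _ _ hU]

end HalfRegion

/-! ### Gluing the two halves along the defect diagonal -/

section Assembly

theorem image_swap_diagCell (p : ℤ × ℤ) (I : Finset ℕ) :
    (I.image (diagCell p.swap)).image Prod.swap = I.image (diagCell p) := by
  rw [Finset.image_image]; rfl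

theorem mem_image_swap {R : Finset (ℤ × ℤ)} {c : ℤ × ℤ} : c ∈ R.image Prod.swap ↔ c.swap ∈ R := by
  rw [Finset.mem_image]
  exact ⟨by rintro ⟨d, hd, rfl⟩; simpa using hd, fun h => ⟨_, h, Prod.swap_swap c⟩⟩

/-- The diagonal through `p` restricted to the indices in `T`, together with `2 * n + 1` diagonals
above it and `2 * n' + 1` diagonals below it. -/
def slicedRegion (a n n' : ℕ) (p : ℤ × ℤ) (T : Finset ℕ) : Finset (ℤ × ℤ) :=
  upperRows a n p ∪ T.image (diagCell p) ∪ (upperRows a n' p.swap).image Prod.swap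

theorem numTilings_slicedRegion_eq_sum (a n n' : ℕ) (p : ℤ × ℤ) (T : Finset ℕ)
    (hT : T ⊆ Finset.range (a + 1)) :
    (numTilings (slicedRegion a n n' p T) : ℚ) =
      2 ^ (n * (n + 1) / 2) / (n.superFactorial : ℚ) *
        (2 ^ (n' * (n' + 1) / 2) / (n'.superFactorial : ℚ)) *
      ∑ S ∈ T.powerset,
        (if (Finset.range (a + 1) \ S).card = n + 1
          then diffProd Nat.cast (Finset.range (a + 1) \ S) else 0) *
        (if (Finset.range (a + 1) \ (T \ S)).card = n' + 1
          then diffProd Nat.cast (Finset.range (a + 1) \ (T \ S)) else 0) := by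
  rw [slicedRegion, numTilings_cut_diag, Nat.cast_sum, Finset.mul_sum]
  · refine Finset.sum_congr rfl fun S hS => ?_
    rw [Finset.mem_powerset] at hS
    have h1 := numTilings_half a n p (Finset.range (a + 1) \ S) Finset.sdiff_subset
    have h2 := numTilings_half a n' p.swap (Finset.range (a + 1) \ (T \ S)) Finset.sdiff_subset
    rw [Finset.sdiff_sdiff_eq_self (hS.trans hT)] at h1
    rw [Finset.sdiff_sdiff_eq_self (Finset.sdiff_subset.trans hT), ← numTilings_image_swap,
      Finset.image_union, image_swap_diagCell] at h2
    rw [Nat.cast_mul, h1, h2, mul_mul_mul_comm]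
  · intro c hc
    rw [mem_upperRows] at hc
    omega
  · intro c hc
    rw [mem_image_swap, mem_upperRows] at hc
    simp only [Prod.fst_swap, Prod.snd_swap] at hc
    omega

/-- The mixed factors are larger minus smaller index, hence absolute values. They split over `B`, so
a subset and its complement together give the full product over all `t`'s. -/
theorem diffProd_natCast_union (r t : ℕ → ℕ) (A B : Finset ℕ) (hr : StrictMonoOn r (A : Set ℕ))
    (ht : StrictMonoOn t (B : Set ℕ)) (h : Disjoint (A.image r) (B.image t)) :
    diffProd Nat.cast (A.image r ∪ B.image t)
      = diffProd (fun i => (r i : ℚ)) A * diffProd (fun i => (t i : ℚ)) B *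
        ∏ i ∈ B, ∏ j ∈ A, |(t i : ℚ) - r j| := by
  rw [diffProd_union _ h, diffProd_image _ _ _ hr, diffProd_image _ _ _ ht,
    Finset.prod_image hr.injOn, Finset.prod_comm (s := B)]
  congr 1
  refine Finset.prod_congr rfl fun i _ => ?_
  rw [Finset.prod_image ht.injOn]
  refine Finset.prod_congr rfl fun j _ => ?_
  split_ifs with hlt
  · rw [abs_sub_comm, abs_of_nonneg]
    exact sub_nonneg.mpr (Nat.cast_le.mpr hlt.le)
  · rw [abs_of_nonneg]
    exact sub_nonneg.mpr (Nat.cast_le.mpr (not_lt.mp hlt))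

/-- When `S` is matched upwards, the upper half misses the `r`'s and the `t`'s outside `S`, and the
lower half misses the `r`'s and the `t`'s in `S`. The size conditions `hpm` and `hqm` then say that
exactly `p'` indices are matched upwards and `q` downwards. -/
theorem numTilings_slicedRegion (a n n' m p' q : ℕ) (p : ℤ × ℤ) (r t : ℕ → ℕ)
    (hpm : p' + m = n' + 1) (hqm : q + m = n + 1) (hpq : p' = q ∨ p' = q + 1)
    (hr : StrictMonoOn r (Set.Iio m)) (ht : StrictMonoOn t (Set.Iio (p' + q)))
    (hdisj : Disjoint ((Finset.range m).image r) ((Finset.range (p' + q)).image t))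
    (hunion : (Finset.range m).image r ∪ (Finset.range (p' + q)).image t = Finset.range (a + 1)) :
    (numTilings (slicedRegion a n n' p ((Finset.range (p' + q)).image t)) : ℚ) =
      2 ^ (n * (n + 1) / 2) / (n.superFactorial : ℚ) *
        (2 ^ (n' * (n' + 1) / 2) / (n'.superFactorial : ℚ)) * 2 ^ q *
      ((∏ i ∈ Finset.range m, ∏ j ∈ Finset.range i, ((r i : ℚ) - r j) ^ 2) *
        ∏ i ∈ Finset.range (p' + q), ∏ j ∈ Finset.range m, |(t i : ℚ) - r j|) *
      diffProd (fun i => (t (2 * i) : ℚ)) (Finset.range p') *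
      diffProd (fun i => (t (2 * i + 1) : ℚ)) (Finset.range q) := by
  set N := p' + q with hN
  rw [← Finset.coe_range] at hr ht
  rw [numTilings_slicedRegion_eq_sum _ _ _ _ _ (hunion ▸ Finset.subset_union_right),
    Finset.powerset_image, Finset.sum_image]
  · have hterm : ∀ S ∈ (Finset.range N).powerset,
        (if (Finset.range (a + 1) \ S.image t).card = n + 1
          then diffProd Nat.cast (Finset.range (a + 1) \ S.image t) else 0) *
        (if (Finset.range (a + 1) \ ((Finset.range N).image t \ S.image t)).card = n' + 1
          then diffProd Nat.cast
            (Finset.range (a + 1) \ ((Finset.range N).image t \ S.image t)) else 0)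
        = if S.card = p' then
            ((∏ i ∈ Finset.range m, ∏ j ∈ Finset.range i, ((r i : ℚ) - r j) ^ 2) *
              ∏ i ∈ Finset.range N, ∏ j ∈ Finset.range m, |(t i : ℚ) - r j|) *
            (diffProd (fun i => (t i : ℚ)) S *
              diffProd (fun i => (t i : ℚ)) (Finset.range N \ S)) else 0 := by
      intro S hS
      rw [Finset.mem_powerset] at hS
      have himg : (Finset.range N).image t \ S.image t = (Finset.range N \ S).image t := by
        ext x
        simp only [Finset.mem_sdiff, Finset.mem_image]
        constructor
        · rintro ⟨⟨i, hi, rfl⟩, h⟩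
          exact ⟨i, ⟨hi, fun hiS => h ⟨i, hiS, rfl⟩⟩, rfl⟩
        · rintro ⟨i, ⟨hi, hiS⟩, rfl⟩
          refine ⟨⟨i, hi, rfl⟩, ?_⟩
          rintro ⟨j, hj, hji⟩
          exact hiS (ht.injOn (hS hj) hi hji ▸ hj)
      have hcomp : ∀ S ⊆ Finset.range N, Finset.range (a + 1) \ (Finset.range N \ S).image t
          = (Finset.range m).image r ∪ S.image t := by
        intro S hS
        have hd : Disjoint (S.image t) ((Finset.range N \ S).image t) := by
          rw [Finset.disjoint_left]
          intro x hx hx'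
          obtain ⟨i, hi, rfl⟩ := Finset.mem_image.mp hx
          obtain ⟨j, hj, hji⟩ := Finset.mem_image.mp hx'
          rw [Finset.mem_sdiff] at hj
          exact hj.2 (ht.injOn hj.1 (hS hi) hji ▸ hi)
        have hd' := hdisj.mono_right
          (Finset.image_subset_image (f := t) (Finset.sdiff_subset (s := Finset.range N) (t := S)))
        have hu : (Finset.range N).image t = S.image t ∪ (Finset.range N \ S).image t := by
          rw [← Finset.image_union, Finset.union_sdiff_of_subset hS]
        rw [← hunion, hu, ← Finset.union_assoc, Finset.union_sdiff_cancel_right]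
        exact Finset.disjoint_union_left.mpr ⟨hd', hd⟩
      have hcard : ∀ S ⊆ Finset.range N, ((Finset.range m).image r ∪ S.image t).card
          = m + S.card := by
        intro S hS
        rw [Finset.card_union_of_disjoint
          (hdisj.mono_right (Finset.image_subset_image (f := t) hS)),
          Finset.card_image_of_injOn hr.injOn, Finset.card_range,
          Finset.card_image_of_injOn (ht.injOn.mono (Finset.coe_subset.mpr hS))]
      have hval : ∀ S ⊆ Finset.range N, diffProd Nat.cast ((Finset.range m).image r ∪ S.image t)
          = diffProd (fun i => (r i : ℚ)) (Finset.range m) * diffProd (fun i => (t i : ℚ)) S *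
            ∏ i ∈ S, ∏ j ∈ Finset.range m, |(t i : ℚ) - r j| := fun S hS =>
        diffProd_natCast_union r t _ _ hr (ht.mono (Finset.coe_subset.mpr hS))
          (hdisj.mono_right (Finset.image_subset_image (f := t) hS))
      have hc := Finset.card_sdiff_add_card_eq_card hS
      rw [Finset.card_range] at hc
      have hcomp' := hcomp (Finset.range N \ S) Finset.sdiff_subset
      rw [Finset.sdiff_sdiff_eq_self hS] at hcomp'
      rw [himg, hcomp S hS, hcomp', hcard S hS, hcard _ Finset.sdiff_subset, hval S hS,
        hval _ Finset.sdiff_subset]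
      by_cases hp : S.card = p'
      · rw [if_pos hp, if_pos (by omega), if_pos (by omega),
          ← Finset.prod_sdiff (s₂ := Finset.range N) hS, diffProd_range]
        simp only [Finset.prod_pow]
        ring
      · rw [if_neg hp, if_neg (by omega), zero_mul]
    rw [Finset.sum_congr rfl hterm, ← Finset.sum_filter, ← Finset.mul_sum,
      ← Finset.powersetCard_eq_filter, sum_diffProd_mul_diffProd _ _ _ hpq]
    ring
  · intro S hS S' hS' h
    rw [Finset.mem_coe, Finset.mem_powerset] at hS hS'
    have h' := congrArg (fun s : Finset ℕ => (s : Set ℕ)) h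
    simp only [Finset.coe_image] at h'
    exact Finset.coe_injective ((ht.injOn.image_eq_image_iff (Finset.coe_subset.mpr hS)
      (Finset.coe_subset.mpr hS')).mp h')

/-- The occupied diagonals run from `-b` to `b`, leaving `b - δ` above the defect diagonal and `b +
δ` below; `p` is the square of index `0`. -/
theorem defectiveAztecRectangle_eq_slicedRegion (a b n n' m : ℕ) (δ : ℤ) (p : ℤ × ℤ)
    (r : ℕ → ℕ) (T : Finset ℕ) (hδ : p.2 - p.1 = δ) (hp : p.1 + p.2 = (b : ℤ) - 2 * a - 1)
    (hn : δ + (2 * n + 1) = b) (hn' : 2 * n' + 1 = b + δ)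
    (hT : ∀ i, i ∈ T ↔ i ≤ a ∧ ∀ j < m, r j ≠ i) :
    defectiveAztecRectangle a b δ m r = slicedRegion a n n' p T := by
  ext c
  rw [defectiveAztecRectangle, Finset.mem_filter, mem_undentedAztecRectangle, slicedRegion,
    Finset.mem_union, Finset.mem_union, mem_upperRows, mem_image_swap, mem_upperRows,
    Finset.mem_image]
  simp only [Prod.fst_swap, Prod.snd_swap, SquareInBounds, IsDiagonalSquare, diagCell]
  by_cases hc : c.2 - c.1 = δ
  · constructor
    · rintro ⟨h1, h2⟩
      refine Or.inl (Or.inr ⟨(c.1 - p.1).toNat, (hT _).mpr ⟨by omega, fun j hj hj' => ?_⟩, ?_⟩)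
      · exact h2 ⟨j, hj, hc, by omega⟩
      · ext <;> simp only <;> omega
    · rintro ((h | ⟨i, hi, rfl⟩) | h)
      · omega
      · have hi' := (hT i).mp hi
        simp only at hc ⊢
        refine ⟨by omega, ?_⟩
        rintro ⟨j, hj, -, h⟩
        exact hi'.2 j hj (by omega)
      · omega
  · constructor
    · rintro ⟨h1, -⟩
      rcases lt_or_gt_of_ne hc with h | h
      · right; omega
      · left; left; omega
    · rintro ((h | ⟨i, hi, rfl⟩) | h)
      · exact ⟨by omega, fun ⟨i, _, h, _⟩ => hc h⟩
      · exact absurd (by simp only; omega) hc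
      · exact ⟨by omega, fun ⟨i, _, h, _⟩ => hc h⟩

theorem defectiveAztecRectangle_neg (a b m : ℕ) (δ : ℤ) (r : ℕ → ℕ) :
    defectiveAztecRectangle a b (-δ) m r
      = (defectiveAztecRectangle a b δ m r).image Prod.swap := by
  ext c
  rw [mem_image_swap, defectiveAztecRectangle, defectiveAztecRectangle, Finset.mem_filter,
    Finset.mem_filter, mem_undentedAztecRectangle, mem_undentedAztecRectangle]
  simp only [SquareInBounds, IsDiagonalSquare, Prod.fst_swap, Prod.snd_swap]
  refine and_congr (by omega) (not_congr (exists_congr fun i => and_congr_right fun _ => ?_))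
  omega

end Assembly

/-! ### The two tiling formulas -/

theorem mainTheorem12 (a b : ℕ) (hab : a < b) (hba : b ≤ 2 * a + 1)
    -- the indices `r 0 < ⋯ < r (b - a - 1)` of the missing squares
    (r : ℕ → ℕ) (hr : StrictMonoOn r (Set.Iio (b - a))) (hra : ∀ i < b - a, r i ≤ a)
    -- the complementary indices `t 0 < ⋯ < t (2 * a - b)`
    (t : ℕ → ℕ) (ht : StrictMonoOn t (Set.Iio (2 * a + 1 - b)))
    (htr : t '' Set.Iio (2 * a + 1 - b) = {n | n ≤ a ∧ ∀ i < b - a, r i ≠ n}) :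
    -- odd `b`: the long diagonal through the centre
    (∀ k : ℕ, b = 2 * k + 1 →
      ((dominoTilings (defectiveAztecRectangle a b 0 (b - a) r)).card : ℚ) =
        2 ^ (k ^ 2 + a) / (k.superFactorial : ℚ) ^ 2 *
        ((∏ i ∈ Finset.range (2 * k + 1 - a), ∏ j ∈ Finset.range i, ((r i : ℚ) - r j) ^ 2) *
          ∏ i ∈ Finset.range (2 * a - 2 * k), ∏ j ∈ Finset.range (2 * k + 1 - a),
            |(t i : ℚ) - r j|) *
        (Matrix.of fun i j : Fin (a - k) => (t (2 * (i : ℕ)) : ℚ) ^ (j : ℕ)).det *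
        (Matrix.of fun i j : Fin (a - k) => (t (2 * (i : ℕ) + 1) : ℚ) ^ (j : ℕ)).det) ∧
    -- even `b`: either of the two diagonals of length `a + 1` next to the centre
    (∀ k : ℕ, b = 2 * k → ∀ δ : ℤ, δ = 1 ∨ δ = -1 →
      ((dominoTilings (defectiveAztecRectangle a b δ (b - a) r)).card : ℚ) =
        2 ^ (k ^ 2 - k + a) / (((k - 1).superFactorial : ℚ) * (k.superFactorial : ℚ)) *
        ((∏ i ∈ Finset.range (2 * k - a), ∏ j ∈ Finset.range i, ((r i : ℚ) - r j) ^ 2) *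
          ∏ i ∈ Finset.range (2 * a - 2 * k + 1), ∏ j ∈ Finset.range (2 * k - a),
            |(t i : ℚ) - r j|) *
        (Matrix.of fun i j : Fin (a - k + 1) => (t (2 * (i : ℕ)) : ℚ) ^ (j : ℕ)).det *
        (Matrix.of fun i j : Fin (a - k) => (t (2 * (i : ℕ) + 1) : ℚ) ^ (j : ℕ)).det) := by
  have hT : ∀ i, i ∈ (Finset.range (2 * a + 1 - b)).image t ↔
      i ≤ a ∧ ∀ j < b - a, r j ≠ i := by
    intro i
    rw [← Finset.mem_coe, Finset.coe_image, Finset.coe_range, htr]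
    rfl
  have hdisj : Disjoint ((Finset.range (b - a)).image r)
      ((Finset.range (2 * a + 1 - b)).image t) := by
    rw [Finset.disjoint_left]
    intro x hx hx'
    obtain ⟨i, hi, rfl⟩ := Finset.mem_image.mp hx
    exact ((hT _).mp hx').2 i (Finset.mem_range.mp hi) rfl
  have hunion : (Finset.range (b - a)).image r ∪ (Finset.range (2 * a + 1 - b)).image t
      = Finset.range (a + 1) := by
    ext x
    rw [Finset.mem_union, hT, Finset.mem_image, Finset.mem_range]
    constructor
    · rintro (⟨i, hi, rfl⟩ | h)
      · exact Nat.lt_succ_of_le (hra i (Finset.mem_range.mp hi))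
      · exact Nat.lt_succ_of_le h.1
    · intro hx
      by_cases h : ∃ i < b - a, r i = x
      · obtain ⟨i, hi, h⟩ := h
        exact Or.inl ⟨i, Finset.mem_range.mpr hi, h⟩
      · push Not at h
        exact Or.inr ⟨Nat.le_of_lt_succ hx, h⟩
  refine ⟨?_, ?_⟩
  · rintro k rfl
    have hN : 2 * a + 1 - (2 * k + 1) = (a - k) + (a - k) := by omega
    rw [hN] at ht hT hdisj hunion
    have key := numTilings_slicedRegion a k k (2 * k + 1 - a) (a - k) (a - k)
      ((k : ℤ) - a, (k : ℤ) - a) r t (by omega) (by omega) (Or.inl rfl) hr ht hdisj hunion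
    rw [← defectiveAztecRectangle_eq_slicedRegion a (2 * k + 1) k k (2 * k + 1 - a) 0 _ r _
      (by simp) (by push_cast; ring) (by push_cast; ring) (by push_cast; ring) hT] at key
    rw [← numTilings, key, det_pow_eq_diffProd (fun i => (t (2 * i) : ℚ)),
      det_pow_eq_diffProd (fun i => (t (2 * i + 1) : ℚ)),
      show 2 * a - 2 * k = (a - k) + (a - k) by omega]
    congr 3
    -- The exponent of `2` is `k * (k + 1) / 2` from each half plus `a - k` from the sum over
    -- splittings.
    rw [div_mul_div_comm, div_mul_eq_mul_div, ← pow_add, ← pow_add, ← sq]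
    congr 2
    have h2 := Nat.div_mul_cancel (Nat.even_mul_succ_self k).two_dvd
    have h3 : k * (k + 1) = k ^ 2 + k := by ring
    omega
  · rintro k rfl δ hδ
    have hN : 2 * a + 1 - 2 * k = (a - k + 1) + (a - k) := by omega
    rw [hN] at ht hT hdisj hunion
    -- Since `a < b`, `k` is positive; the shift removes the truncated `k - 1`. For `δ = 1` the
    -- upper half has parameter `k` and the lower one `k + 1`, in the new `k`.
    obtain ⟨k, rfl⟩ : ∃ l, k = l + 1 := ⟨k - 1, by omega⟩
    have key := numTilings_slicedRegion a k (k + 1) (2 * (k + 1) - a) (a - (k + 1) + 1)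
      (a - (k + 1)) ((k : ℤ) - a, (k : ℤ) + 1 - a) r t (by omega) (by omega) (Or.inr rfl) hr ht
      hdisj hunion
    rw [← defectiveAztecRectangle_eq_slicedRegion a (2 * (k + 1)) k (k + 1) (2 * (k + 1) - a) 1 _ r
      _ (by simp only; ring) (by push_cast; ring) (by push_cast; ring) (by push_cast; ring) hT]
      at key
    -- Reflection in `y = x` exchanges the two diagonals and preserves the indices.
    have hsym : numTilings (defectiveAztecRectangle a (2 * (k + 1)) δ (2 * (k + 1) - a) r)
        = numTilings (defectiveAztecRectangle a (2 * (k + 1)) 1 (2 * (k + 1) - a) r) := by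
      rcases hδ with rfl | rfl
      · rfl
      · rw [defectiveAztecRectangle_neg, numTilings_image_swap]
    rw [← numTilings, hsym, key, det_pow_eq_diffProd (fun i => (t (2 * i) : ℚ)),
      det_pow_eq_diffProd (fun i => (t (2 * i + 1) : ℚ)),
      show 2 * a - 2 * (k + 1) + 1 = (a - (k + 1) + 1) + (a - (k + 1)) by omega,
      Nat.add_sub_cancel]
    congr 3
    rw [div_mul_div_comm, div_mul_eq_mul_div, ← pow_add, ← pow_add]
    congr 2
    have h2 := Nat.div_mul_cancel (Nat.even_mul_succ_self k).two_dvd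
    have h3 := Nat.div_mul_cancel (Nat.even_mul_succ_self (k + 1)).two_dvd
    have h4 : k * (k + 1) = k ^ 2 + k := by ring
    have h5 : (k + 1) * (k + 1 + 1) = k ^ 2 + 3 * k + 2 := by ring
    have h6 : (k + 1) ^ 2 = k ^ 2 + 2 * k + 1 := by ring
    omega
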